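/- Let $H$ be the binary Hamming code of length $15$ (the coordinates are labelled, in any order, by the $15$ nonzero vectors of $\mathbb F_2^4$, and these vectors are the columns of the parity check matrix), and let $C$ be the simplex code, the row space of the same $4\times 15$ matrix. For a code $D\le\mathbb F_2^{15}$ let $\mathrm{Aut}(D)$ be the group of permutations $\pi\in S_{15}$ with $c^\pi=(c_{\pi(1)},\dots,c_{\pi(15)})\in D$ for all $c\in D$. For $C_2\le C_1\le\mathbb F_2^{15}$ the CSS code of $C_2\le C_1$ is the span of the states $|\psi_v\rangle=|C_2|^{-1/2}\sum_{c\in C_2}|c+v\rangle$, $v\in C_1$. These are labelled by $Q=C_1/C_2$, and $\pi\in\mathrm{Aut}(C_1)\cap\mathrm{Aut}(C_2)$ acts on $Q$ by $T_1(\pi)\colon v+C_2\mapsto v^\pi+C_2$. Let $G_{12}\le \mathrm{GL}(Q\times Q)$ be the group generated by $(x,y)\mapsto(x,x+y)$, $(x,y)\mapsto(x+y,y)$ and all $\mathrm{diag}(T_1(\pi_1),T_1(\pi_2))$ with $\pi_1,\pi_2\in\mathrm{Aut}(C_1)\cap\mathrm{Aut}(C_2)$, and let $\tilde G_1\le G_{12}$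 be the subgroup of all elements of $G_{12}$ of the form $\mathrm{diag}(h,1)$. Let $P$ be the group of unitaries on two blocks of $15$ qubits generated by the transversal CNOTs with all controls in the first, or all in the second, block and by the permutations of the qubits within each block by elements of $\mathrm{Aut}(C_1)\cap\mathrm{Aut}(C_2)$. We say that $U\in P$ realizes $g\in\mathrm{GL}(Q\times Q)$ if $U|\psi_u\rangle|\psi_v\rangle=|\psi_{u'}\rangle|\psi_{v'}\rangle$ whenever $g(u+C_2,v+C_2)=(u'+C_2,v'+C_2)$. (1) $H$ is a $[15,11,3]$ code, $C$ is a $[15,4,8]$ code, $C=H^\perp$, $H=C^\perp$, $C\le H$, and $\mathrm{Aut}(H)\cap\mathrm{Aut}(C)=\mathrm{Aut}(C)$ is isomorphic to the alternating group $A_8$, of order $20160$. (2) The CSS code of $C\le H$ has parameters $[\![15,7,3]\!]$. In a suitable basis of $H/C$, the group $\{T_1(\pi):\pi\in\mathrm{Aut}(C)\}$ is the matrix group generated by $$\begin{pmatrix}1&0&0&1&1&0&1\\1&1&0&0&1&0&0\\1&1&1&0&1&1&1\\1&1&0&0&0&1&0\\0&1&0&0&1&0&1\\0&0&0&1&1&0&1\\1&1&0&0&1&1&0\end{pmatrix},\qquad\begin{pmatrix}1&0&1&0&0&1&0\\1&1&1&1&1&0&0\\0&1&1&0&1&1&0\\0&1&0&1&0&1&1\\1&0&0&1&0&0&0\\0&1&0&0&1&1&0\\0&1&1&1&1&0&1\end{pmatrix}.$$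 (3) For this code $G_{12}\cong\mathrm{SL}(12,2)\times\mathrm{SL}(2,2)$, $|G_{12}|>2^{144}$, and $\tilde G_1\cong\mathrm{SL}(6,2)$. Every element of $G_{12}$ is realized by an element of $P$, and every element of $P$ realizes an element of $G_{12}$. (4) The all-one vector $\mathbf 1$ lies in $H$ and not in $C$; it corresponds to the logical operator $X^{\otimes 15}$, in that $X^{\otimes 15}|\psi_v\rangle=|\psi_{v+\mathbf 1}\rangle$; and $\mathbf 1$ and $X^{\otimes 15}$ are invariant under all permutations of the coordinates, respectively of the qubits. (5) Let $H_0$ be the subcode of all words of even weight in $H$. Then $C\le H_0$, $H=H_0\oplus\langle\mathbf 1\rangle$, $\mathrm{Aut}(H_0)\cap\mathrm{Aut}(C)=\mathrm{Aut}(C)$, and the CSS code of $C\le H_0$ is a subcode of the CSS code of $C\le H$ with parameters $[\![15,6,3]\!]$. For this subcode the full linear group is obtained on one and on two blocks: $\mathrm{GL}(H_0/C)\cong\mathrm{SL}(6,2)$, every $\mathrm{diag}(h,1)$ with $h\in\mathrm{GL}(H_0/C)$ lies in $\tilde G_1$ and is realized by an element of $P$; and $G_{12}=\mathrm{GL}(H_0/C\times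 H_0/C)\cong\mathrm{SL}(12,2)$, each element being realized by an element of $P$. -/

import Mathlib

noncomputable section

namespace CSS

/-! ### Binary linear codes -/

/-- Binary words of length `n`. -/
abbrev Word (n : ℕ) : Type := Fin n → ZMod 2

/-- The dual code for the standard bilinear form. -/
def dualCode {n : ℕ} (C : Submodule (ZMod 2) (Word n)) : Submodule (ZMod 2) (Word n) where
  carrier := {x | ∀ c ∈ C, c ⬝ᵥ x = 0}
  add_mem' := by
    intro x y hx hy c hc
    rw [dotProduct_add, hx c hc, hy c hc, add_zero]
  zero_mem' := by
    intro c _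
    exact dotProduct_zero c
  smul_mem' := by
    intro a x hx c hc
    rw [dotProduct_smul, hx c hc, smul_zero]

/-- `C` is an `[n, k, d]` code: it has dimension `k`, and `d` is the minimum of the weights of its
nonzero words. -/
def IsLinearCode {n : ℕ} (C : Submodule (ZMod 2) (Word n)) (k d : ℕ) : Prop :=
  Module.finrank (ZMod 2) C = k ∧ IsLeast {w : ℕ | ∃ c ∈ C, c ≠ 0 ∧ hammingNorm c = w} d

/-- The map `c ↦ c^π = (c_{π(1)}, …, c_{π(n)})`. -/
def permWord {n : ℕ} (π : Equiv.Perm (Fin n)) : Word n ≃ₗ[ZMod 2] Word n :=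
  LinearEquiv.funCongrLeft (ZMod 2) (ZMod 2) π

theorem permWord_apply {n : ℕ} (π : Equiv.Perm (Fin n)) (c : Word n) (i : Fin n) :
    permWord π c i = c (π i) := rfl

/-- The permutation automorphism group of a code. -/
def permAut {n : ℕ} (C : Submodule (ZMod 2) (Word n)) : Subgroup (Equiv.Perm (Fin n)) :=
  subgroupOfFinite
    { carrier := {π | ∀ c ∈ C, permWord π c ∈ C}
      mul_mem' := by
        intro π σ hπ hσ c hc
        exact hσ _ (hπ c hc)
      one_mem' := by
        intro c hc
        exact hc }
where
  /-- A submonoid of a finite group is a subgroup. -/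
  subgroupOfFinite {n : ℕ} (S : Submonoid (Equiv.Perm (Fin n))) :
      Subgroup (Equiv.Perm (Fin n)) :=
    { S with
      inv_mem' := by
        intro π hπ
        have h : π⁻¹ = π ^ (orderOf π - 1) := by
          rw [inv_eq_iff_mul_eq_one, ← pow_succ', Nat.sub_add_cancel (orderOf_pos π),
            pow_orderOf_eq_one]
        change π⁻¹ ∈ S
        rw [h]
        exact S.pow_mem hπ _ }

theorem mem_permAut {n : ℕ} {C : Submodule (ZMod 2) (Word n)} {π : Equiv.Perm (Fin n)} :
    π ∈ permAut C ↔ ∀ c ∈ C, permWord π c ∈ C := Iff.rfl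

/-- The joint permutation automorphisms of a pair of codes. -/
def jointAut {n : ℕ} (C₁ C₂ : Submodule (ZMod 2) (Word n)) : Subgroup (Equiv.Perm (Fin n)) :=
  permAut C₁ ⊓ permAut C₂

theorem map_permWord {n : ℕ} {C : Submodule (ZMod 2) (Word n)} {π : Equiv.Perm (Fin n)}
    (hπ : π ∈ permAut C) :
    C.map (permWord π : Word n →ₗ[ZMod 2] Word n) = C := by
  apply le_antisymm
  · rintro _ ⟨c, hc, rfl⟩
    exact hπ c hc
  · intro c hc
    refine ⟨permWord π⁻¹ c, (permAut C).inv_mem hπ c hc, ?_⟩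
    funext i
    change c (π⁻¹ (π i)) = c i
    simp

/-! ### The logical space of a CSS code and the operations on it -/

/-- The space `C₁ / C₂` of cosets, which labels the basis states of the CSS code of `C₂ ≤ C₁`. -/
abbrev Logical {n : ℕ} (C₁ C₂ : Submodule (ZMod 2) (Word n)) : Type :=
  C₁ ⧸ C₂.submoduleOf C₁

/-- The coset of a word of `C₁`. -/
abbrev coset {n : ℕ} (C₁ C₂ : Submodule (ZMod 2) (Word n)) (v : C₁) : Logical C₁ C₂ :=
  Submodule.Quotient.mk v

/-- The restriction of `c ↦ c^π` to a code that `π` preserves. -/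
def permCode {n : ℕ} {C : Submodule (ZMod 2) (Word n)} {π : Equiv.Perm (Fin n)}
    (hπ : π ∈ permAut C) : C ≃ₗ[ZMod 2] C :=
  (permWord π).ofSubmodules C C (map_permWord hπ)

/-- The linear operation `T₁(π)` on `C₁ / C₂` induced by a joint automorphism `π`: it sends the
coset of `v` to the coset of `v^π`. -/
def logicalPerm {n : ℕ} {C₁ C₂ : Submodule (ZMod 2) (Word n)} (π : jointAut C₁ C₂) :
    Logical C₁ C₂ ≃ₗ[ZMod 2] Logical C₁ C₂ :=
  Submodule.Quotient.equiv _ _ (permCode π.2.1) (by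
    apply le_antisymm
    · rintro _ ⟨c, hc, rfl⟩
      exact π.2.2 _ hc
    · intro c hc
      refine ⟨(permCode π.2.1).symm c, ?_, ?_⟩
      · have h := map_permWord π.2.2
        have hc' : (c : Word n) ∈ C₂ := hc
        rw [← h] at hc'
        obtain ⟨d, hd, hdc⟩ := hc'
        have h2 : (((permCode π.2.1).symm c : C₁) : Word n) = d := by
          apply (permWord π.1).injective
          have h3 : permWord π.1 (((permCode π.2.1).symm c : C₁) : Word n) =
              ((permCode π.2.1 ((permCode π.2.1).symm c) : C₁) : Word n) := rfl
          rw [h3, LinearEquiv.apply_symm_apply]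
          exact hdc.symm
        change (((permCode π.2.1).symm c : C₁) : Word n) ∈ C₂
        rw [h2]
        exact hd
      · exact (permCode π.2.1).apply_symm_apply c)

theorem logicalPerm_coset {n : ℕ} {C₁ C₂ : Submodule (ZMod 2) (Word n)} (π : jointAut C₁ C₂)
    (v : C₁) :
    logicalPerm π (coset C₁ C₂ v) = coset C₁ C₂ ⟨permWord π.1 v, π.2.1 v v.2⟩ := rfl

/-- `(x, y) ↦ (x, x + y)`. -/
def cnot₁₂ (V : Type*) [AddCommGroup V] [Module (ZMod 2) V] : (V × V) ≃ₗ[ZMod 2] (V × V) where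
  toFun p := (p.1, p.1 + p.2)
  invFun p := (p.1, p.2 - p.1)
  map_add' p q := by ext <;> simp [add_add_add_comm]
  map_smul' a p := by ext <;> simp
  left_inv p := by ext <;> simp
  right_inv p := by ext <;> simp

/-- `(x, y) ↦ (x + y, y)`. -/
def cnot₂₁ (V : Type*) [AddCommGroup V] [Module (ZMod 2) V] : (V × V) ≃ₗ[ZMod 2] (V × V) where
  toFun p := (p.1 + p.2, p.2)
  invFun p := (p.1 - p.2, p.2)
  map_add' p q := by ext <;> simp [add_add_add_comm]
  map_smul' a p := by ext <;> simp
  left_inv p := by ext <;> simp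
  right_inv p := by ext <;> simp

/-- The group `G₁₂` of linear transformations of two copies of `C₁ / C₂`, generated by the two
transversal CNOTs and the block-diagonal maps `diag(T₁(π₁), T₁(π₂))`. -/
def G12 {n : ℕ} (C₁ C₂ : Submodule (ZMod 2) (Word n)) :
    Subgroup ((Logical C₁ C₂ × Logical C₁ C₂) ≃ₗ[ZMod 2] (Logical C₁ C₂ × Logical C₁ C₂)) :=
  Subgroup.closure
    ({cnot₁₂ (Logical C₁ C₂), cnot₂₁ (Logical C₁ C₂)} ∪
      {g | ∃ π₁ π₂ : jointAut C₁ C₂, g = (logicalPerm π₁).prodCongr (logicalPerm π₂)})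

/-- The block-diagonal map `diag(h, 1)`, as a homomorphism in `h`. -/
def firstBlock (V : Type*) [AddCommGroup V] [Module (ZMod 2) V] :
    (V ≃ₗ[ZMod 2] V) →* ((V × V) ≃ₗ[ZMod 2] (V × V)) where
  toFun h := h.prodCongr (LinearEquiv.refl (ZMod 2) V)
  map_one' := by ext p <;> rfl
  map_mul' g h := by ext p <;> rfl

/-- The subgroup of `G₁₂` of all block-diagonal elements that act trivially on the second block. -/
def G1tilde {n : ℕ} (C₁ C₂ : Submodule (ZMod 2) (Word n)) :
    Subgroup ((Logical C₁ C₂ × Logical C₁ C₂) ≃ₗ[ZMod 2] (Logical C₁ C₂ × Logical C₁ C₂)) :=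
  G12 C₁ C₂ ⊓ (firstBlock (Logical C₁ C₂)).range

/-! ### Quantum states and operations -/

/-- The Hilbert space of one block of `n` qubits, with orthonormal basis `|w⟩`, `w : Word n`. -/
abbrev Block (n : ℕ) : Type := EuclideanSpace ℂ (Word n)

/-- The Hilbert space of two blocks of `n` qubits, with orthonormal basis `|w₁⟩|w₂⟩`. -/
abbrev TwoBlocks (n : ℕ) : Type := EuclideanSpace ℂ (Word n × Word n)

/-- The product state `φ ⊗ ψ`. -/
def tensor {n : ℕ} (φ ψ : Block n) : TwoBlocks n :=
  WithLp.toLp 2 fun w => φ w.1 * ψ w.2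

open Classical in
/-- The state `|ψ_v⟩ = |C|^{-1/2} ∑_{c ∈ C} |c + v⟩`. -/
def cosetState {n : ℕ} (C : Submodule (ZMod 2) (Word n)) (v : Word n) : Block n :=
  (1 / (Real.sqrt (Nat.card C) : ℂ)) •
    ∑ c : Word n with c ∈ C, EuclideanSpace.single (c + v) (1 : ℂ)

/-- The CSS code of `C₂ ≤ C₁`: the span of the states `|ψ_v⟩`, `v ∈ C₁`. -/
def codeSpace {n : ℕ} (C₁ C₂ : Submodule (ZMod 2) (Word n)) : Submodule ℂ (Block n) :=
  Submodule.span ℂ (cosetState C₂ '' (C₁ : Set (Word n)))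

/-- The Pauli operator `X^a Z^b`, that is, `|w⟩ ↦ (-1)^{b·w} |w + a⟩`. -/
def pauli {n : ℕ} (a b : Word n) (φ : Block n) : Block n :=
  WithLp.toLp 2 fun w => (if b ⬝ᵥ (w - a) = 0 then 1 else -1) * φ (w - a)

/-- The number of qubits on which `X^a Z^b` acts nontrivially. -/
def pauliWeight {n : ℕ} (a b : Word n) : ℕ :=
  (Finset.univ.filter fun i => a i ≠ 0 ∨ b i ≠ 0).card

/-- The code `Q` detects the error `X^a Z^b`. -/
def Detects {n : ℕ} (Q : Submodule ℂ (Block n)) (a b : Word n) : Prop :=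
  ∃ μ : ℂ, ∀ φ ∈ Q, ∀ ψ ∈ Q, inner ℂ φ (pauli a b ψ) = μ * inner ℂ φ ψ

/-- `Q` is an `[[n, k, d]]` code: it has dimension `2 ^ k`, and `d` is the minimum weight of a
Pauli error that it does not detect. -/
def IsQuantumCode {n : ℕ} (Q : Submodule ℂ (Block n)) (k d : ℕ) : Prop :=
  Module.finrank ℂ Q = 2 ^ k ∧
    IsLeast {w : ℕ | ∃ a b : Word n, ¬ Detects Q a b ∧ pauliWeight a b = w} d

/-- The unitary that permutes the computational basis of two blocks, `|w⟩ ↦ |f w⟩`. -/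
def basisUnitary {n : ℕ} (f : (Word n × Word n) ≃ (Word n × Word n)) :
    TwoBlocks n ≃ₗᵢ[ℂ] TwoBlocks n :=
  LinearIsometryEquiv.piLpCongrLeft 2 ℂ ℂ f

/-- The permutation `|c⟩ ↦ |c^π⟩` of the qubits of one block. -/
def permuteQubits {n : ℕ} (π : Equiv.Perm (Fin n)) : Block n ≃ₗᵢ[ℂ] Block n :=
  LinearIsometryEquiv.piLpCongrLeft 2 ℂ ℂ (permWord π).toEquiv

/-- The group of unitaries on two blocks that is generated by the transversal CNOTs with all
controls in the first or in the second block and by the permutations of the qubits within each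
block by joint automorphisms. -/
def physicalGroup {n : ℕ} (C₁ C₂ : Submodule (ZMod 2) (Word n)) :
    Subgroup (TwoBlocks n ≃ₗᵢ[ℂ] TwoBlocks n) :=
  Subgroup.closure
    ({basisUnitary (cnot₁₂ (Word n)).toEquiv, basisUnitary (cnot₂₁ (Word n)).toEquiv} ∪
      {U | ∃ π₁ ∈ jointAut C₁ C₂, ∃ π₂ ∈ jointAut C₁ C₂,
        U = basisUnitary ((permWord π₁).prodCongr (permWord π₂)).toEquiv})

/-- The unitary `U` acts on the basis states `|ψ_u⟩|ψ_v⟩` of two code blocks as the linear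
transformation `g` of their labels. -/
def Realizes {n : ℕ} (C₁ C₂ : Submodule (ZMod 2) (Word n)) (U : TwoBlocks n ≃ₗᵢ[ℂ] TwoBlocks n)
    (g : (Logical C₁ C₂ × Logical C₁ C₂) ≃ₗ[ZMod 2] (Logical C₁ C₂ × Logical C₁ C₂)) : Prop :=
  ∀ u v u' v' : C₁, g (coset C₁ C₂ u, coset C₁ C₂ v) = (coset C₁ C₂ u', coset C₁ C₂ v') →
    U (tensor (cosetState C₂ u) (cosetState C₂ v)) =
      tensor (cosetState C₂ u') (cosetState C₂ v')

/-! ### The codes of length 15 -/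

/-- The 4 × 15 matrix whose columns are the nonzero vectors of `𝔽₂⁴`, in the order `e`. -/
def columns (e : Fin 15 ≃ {v : Fin 4 → ZMod 2 // v ≠ 0}) : Matrix (Fin 4) (Fin 15) (ZMod 2) :=
  Matrix.of fun i j => (e j).1 i

/-- The binary Hamming code of length 15: the matrix `columns e` is its parity check matrix. -/
def hamming (e : Fin 15 ≃ {v : Fin 4 → ZMod 2 // v ≠ 0}) : Submodule (ZMod 2) (Word 15) :=
  LinearMap.ker (columns e).mulVecLin

/-- The binary simplex code of length 15: the matrix `columns e` is its generator matrix. -/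
def simplex (e : Fin 15 ≃ {v : Fin 4 → ZMod 2 // v ≠ 0}) : Submodule (ZMod 2) (Word 15) :=
  Submodule.span (ZMod 2) (Set.range (columns e).row)

/-- The subcode of all words of even weight. -/
def evenSubcode {n : ℕ} (C : Submodule (ZMod 2) (Word n)) : Submodule (ZMod 2) (Word n) :=
  C ⊓ LinearMap.ker (∑ i, (LinearMap.proj i : Word n →ₗ[ZMod 2] ZMod 2))

/-- First generator of the action of the automorphism group on the 7 logical qubits. -/
def M₁ : Matrix (Fin 7) (Fin 7) (ZMod 2) :=
  !![1,0,0,1,1,0,1;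
     1,1,0,0,1,0,0;
     1,1,1,0,1,1,1;
     1,1,0,0,0,1,0;
     0,1,0,0,1,0,1;
     0,0,0,1,1,0,1;
     1,1,0,0,1,1,0]

/-- Second generator of the action of the automorphism group on the 7 logical qubits. -/
def M₂ : Matrix (Fin 7) (Fin 7) (ZMod 2) :=
  !![1,0,1,0,0,1,0;
     1,1,1,1,1,0,0;
     0,1,1,0,1,1,0;
     0,1,0,1,0,1,1;
     1,0,0,1,0,0,0;
     0,1,0,0,1,1,0;
     0,1,1,1,1,0,1]

/-- The matrix group generated by `M₁` and `M₂`. -/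
def G1 : Subgroup (GL (Fin 7) (ZMod 2)) :=
  Subgroup.closure {g | g.val = M₁ ∨ g.val = M₂}

end CSS

end

/-!
The coordinates of a word are the nonzero points of `𝔽₂⁴`, so a word is a function on these points.
By linear algebra, `C` is the space of linear functions, and `H`, the dual of `C`, is spanned by
`C`, the six products of two coordinates and the constant `1`; the even words `H₀` are those
without constant term. Hence `H₀ / C` is the six-dimensional space of alternating forms, and
`H / C = H₀ / C ⊕ ⟨1⟩` (`quadBasis`, `splitting`).

A permutation preserves `C` exactly if it is a linear substitution of the points, so that
`Aut(C) ≅ GL(4,2)` (`GLEquivPermAut`), acting on `H₀ / C` by second compound matrices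
(`toMatrix_logicalPerm`). The isomorphism with `A₈` comes from a Kerdock set of eight alternating
matrices: the 28 invertible alternating matrices are the differences of its pairs, and
`M ↦ g M gᵀ` permutes them like a permutation of eight letters permutes the pairs. This embeds
`GL(4,2)` in `S₈` as a subgroup of order `20160`, of index two (`nonempty_GL_four_mulEquiv`).
`GL(4,2)` is generated by two explicit matrices (`closure_genA_genB`); in a suitable basis of
`H / C` they act as `M₁` and `M₂` (`mem_G1_iff`).

For the two-block groups, the commutator of a CNOT and `diag(a, 1)` is the shear
`(x, y) ↦ (x, y + (1 + a) x)` (`lowerShear_one_add_mem`).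
The endomorphisms `m` for which the shear by `m` lies in `G₁₂` form an additive group that is stable
under multiplication by the automorphisms. For two transvections `t`, `t'` on complementary pairs of
coordinates, `(1 + t) (1 + t')` is a matrix unit on the alternating forms, so all shears of two
copies of `H₀ / C` occur (`augmentationFull_logicalPerm`), and these generate the whole linear group
since it is generated by transvections (`eq_top_of_shears_mem`, `blockEmb_mem`). On the two copies
of the all-one word only the CNOTs act, and they generate `SL(2,2)` (`G12_hamming`).

The parameters of the quantum codes follow from the weights of the words in `H = C^⊥`: a Pauli error
`X^a Z^b` of weight less than three is trivial, or moves the code to an orthogonal space, or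
cancels in all inner products, while a phase error on a word of weight three in `H` acts
nontrivially on the code (`isQuantumCode`).
-/

noncomputable section

namespace CSS

open Matrix

/-! ### Linear groups over the field with two elements -/

theorem zmod2_cases (c : ZMod 2) : c = 0 ∨ c = 1 := by
  revert c; decide

theorem zmod2_eq_one {c : ZMod 2} (h : c ≠ 0) : c = 1 :=
  (zmod2_cases c).resolve_left h

/-- Over `𝔽₂` the only invertible diagonal matrix is the identity, so that the transvections alone
generate the general linear group. -/
theorem transvection_induction {n : Type*} [Fintype n] [DecidableEq n]
    (P : Matrix n n (ZMod 2) → Prop) (h1 : P 1)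
    (ht : ∀ i j, i ≠ j → P (Matrix.transvection i j 1)) (hmul : ∀ A B, P A → P B → P (A * B))
    (M : Matrix n n (ZMod 2)) (hM : M.det ≠ 0) : P M := by
  refine diagonal_transvection_induction_of_det_ne_zero P M hM ?_ ?_ fun A B _ _ => hmul A B
  · intro D hD
    rw [det_diagonal, Finset.prod_ne_zero_iff] at hD
    have : D = 1 := funext fun i => zmod2_eq_one (hD i (Finset.mem_univ i))
    rw [this]
    simpa using h1
  · rintro ⟨i, j, hij, c⟩
    rcases zmod2_cases c with rfl | rfl
    · simpa using h1
    · exact ht i j hij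

/-- Over `𝔽₂` every unit is `1`, so that the general and the special linear group agree. -/
def slEquivGL (n : ℕ) :
    Matrix.SpecialLinearGroup (Fin n) (ZMod 2) ≃* GL (Fin n) (ZMod 2) :=
  MulEquiv.ofBijective Matrix.SpecialLinearGroup.toGL
    ⟨Matrix.SpecialLinearGroup.toGL_injective, fun g =>
      ⟨⟨g.val, zmod2_eq_one ((Matrix.isUnit_iff_isUnit_det _).1 g.isUnit).ne_zero⟩, by
        ext; rfl⟩⟩

/-- The linear automorphisms of an `n`-dimensional space over `𝔽₂` form the group `SL(n,2)`. -/
def linearAutEquivSL {n : ℕ} {V : Type*} [AddCommGroup V] [Module (ZMod 2) V]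
    (b : Module.Basis (Fin n) (ZMod 2) V) :
    (V ≃ₗ[ZMod 2] V) ≃* Matrix.SpecialLinearGroup (Fin n) (ZMod 2) :=
  (LinearMap.GeneralLinearGroup.generalLinearEquiv (ZMod 2) V).symm.trans
    ((Units.mapEquiv (LinearMap.toMatrixAlgEquiv b).toMulEquiv).trans (slEquivGL n).symm)

/-! ### Shears of two copies of a space -/

section Shear

variable {V : Type*} [AddCommGroup V] [Module (ZMod 2) V]

theorem add_self_eq_zero_of_zmod2 (x : V) : x + x = 0 := by
  rw [← two_smul (ZMod 2) x, show (2 : ZMod 2) = 0 from rfl, zero_smul]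

/-- The lower shear `(x, y) ↦ (x, y + m x)`. -/
def lowerShear (m : Module.End (ZMod 2) V) : (V × V) ≃ₗ[ZMod 2] (V × V) where
  toFun p := (p.1, p.2 + m p.1)
  invFun p := (p.1, p.2 + m p.1)
  map_add' p q := by ext <;> simp [add_add_add_comm]
  map_smul' a p := by ext <;> simp
  left_inv p := by ext <;> simp [add_assoc, add_self_eq_zero_of_zmod2]
  right_inv p := by ext <;> simp [add_assoc, add_self_eq_zero_of_zmod2]

/-- The upper shear `(x, y) ↦ (x + m y, y)`. -/
def upperShear (m : Module.End (ZMod 2) V) : (V × V) ≃ₗ[ZMod 2] (V × V) where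
  toFun p := (p.1 + m p.2, p.2)
  invFun p := (p.1 + m p.2, p.2)
  map_add' p q := by ext <;> simp [add_add_add_comm]
  map_smul' a p := by ext <;> simp
  left_inv p := by ext <;> simp [add_assoc, add_self_eq_zero_of_zmod2]
  right_inv p := by ext <;> simp [add_assoc, add_self_eq_zero_of_zmod2]

theorem lowerShear_apply (m : Module.End (ZMod 2) V) (p : V × V) :
    lowerShear m p = (p.1, p.2 + m p.1) := rfl

theorem upperShear_apply (m : Module.End (ZMod 2) V) (p : V × V) :
    upperShear m p = (p.1 + m p.2, p.2) := rfl

theorem cnot₁₂_apply (p : V × V) : cnot₁₂ V p = (p.1, p.1 + p.2) := rfl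

theorem cnot₂₁_apply (p : V × V) : cnot₂₁ V p = (p.1 + p.2, p.2) := rfl

theorem toMatrix_upperShear {ι : Type*} [Fintype ι] [DecidableEq ι]
    (B : Module.Basis ι (ZMod 2) V) (i j : ι) :
    LinearMap.toMatrix (B.prod B) (B.prod B)
      (upperShear (Matrix.toLin B B (Matrix.single i j 1))).toLinearMap =
      Matrix.transvection (Sum.inl i) (Sum.inr j) 1 := by
  ext (a | a) (b | b) <;>
  simp [LinearMap.toMatrix_apply, upperShear_apply, Matrix.transvection, Matrix.one_apply,
    Matrix.single_apply, Matrix.toLin_self, Finsupp.single_apply, eq_comm, ite_and]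
  by_cases h : j = b <;> simp [h, Finsupp.single_apply]

theorem toMatrix_lowerShear {ι : Type*} [Fintype ι] [DecidableEq ι]
    (B : Module.Basis ι (ZMod 2) V) (i j : ι) :
    LinearMap.toMatrix (B.prod B) (B.prod B)
      (lowerShear (Matrix.toLin B B (Matrix.single i j 1))).toLinearMap =
      Matrix.transvection (Sum.inr i) (Sum.inl j) 1 := by
  ext (a | a) (b | b) <;>
  simp [LinearMap.toMatrix_apply, lowerShear_apply, Matrix.transvection, Matrix.one_apply,
    Matrix.single_apply, Matrix.toLin_self, Finsupp.single_apply, eq_comm, ite_and]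
  by_cases h : j = b <;> simp [h, Finsupp.single_apply]

/-- A transvection is a commutator of two transvections through a third index. -/
theorem transvection_eq_commutator {n : Type*} [Fintype n] [DecidableEq n] {i j k : n}
    (hij : i ≠ j) (hik : i ≠ k) (hkj : k ≠ j) :
    (Matrix.transvection i j 1 : Matrix n n (ZMod 2)) =
      Matrix.transvection i k 1 * Matrix.transvection k j 1 *
        (Matrix.transvection i k 1 * Matrix.transvection k j 1) := by
  have h2 (M : Matrix n n (ZMod 2)) : M + M = 0 := add_self_eq_zero_of_zmod2 M
  have h : (Matrix.transvection i k 1 * Matrix.transvection k j 1 : Matrix n n (ZMod 2)) =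
      1 + (Matrix.single i k 1 + Matrix.single k j 1 + Matrix.single i j 1) := by
    simp only [Matrix.transvection, add_mul, mul_add, one_mul, mul_one,
      Matrix.single_mul_single_same]
    abel
  rw [h, add_mul, one_mul, mul_add, mul_one, add_assoc,
    ← add_assoc (Matrix.single i k 1 + Matrix.single k j 1 + Matrix.single i j 1), h2, zero_add]
  simp [add_mul, mul_add, Matrix.transvection, hij.symm, hik.symm, hkj.symm]

/-- The shears generate the linear group of two copies of a space. -/
theorem eq_top_of_shears_mem [FiniteDimensional (ZMod 2) V]
    (G : Subgroup ((V × V) ≃ₗ[ZMod 2] (V × V)))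
    (hl : ∀ m, lowerShear m ∈ G) (hu : ∀ m, upperShear m ∈ G) : G = ⊤ := by
  let B := Module.finBasis (ZMod 2) V
  rw [eq_top_iff]
  intro g _
  let P : Matrix _ _ (ZMod 2) → Prop := fun M =>
    ∃ h ∈ G, LinearMap.toMatrix (B.prod B) (B.prod B) h.toLinearMap = M
  have hmul (M N) (hM : P M) (hN : P N) : P (M * N) := by
    obtain ⟨a, ha, rfl⟩ := hM
    obtain ⟨b, hb, rfl⟩ := hN
    exact ⟨a * b, G.mul_mem ha hb, LinearMap.toMatrix_comp _ (B.prod B) _ _ _⟩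
  have hlr (i j) : P (Matrix.transvection (Sum.inl i) (Sum.inr j) 1) :=
    ⟨_, hu _, toMatrix_upperShear B i j⟩
  have hrl (i j) : P (Matrix.transvection (Sum.inr i) (Sum.inl j) 1) :=
    ⟨_, hl _, toMatrix_lowerShear B i j⟩
  have hP : P (LinearMap.toMatrix (B.prod B) (B.prod B) g.toLinearMap) := by
    refine transvection_induction P ⟨1, G.one_mem, LinearMap.toMatrix_one _⟩ ?_ hmul _
      (LinearEquiv.isUnit_det g _ _).ne_zero
    rintro (i | i) (j | j) hij
    · rw [transvection_eq_commutator hij (k := Sum.inr i) (by simp) (by simp)]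
      exact hmul _ _ (hmul _ _ (hlr _ _) (hrl _ _)) (hmul _ _ (hlr _ _) (hrl _ _))
    · exact hlr i j
    · exact hrl i j
    · rw [transvection_eq_commutator hij (k := Sum.inl i) (by simp) (by simp)]
      exact hmul _ _ (hmul _ _ (hrl _ _) (hlr _ _)) (hmul _ _ (hrl _ _) (hlr _ _))
  obtain ⟨h, hG, hh⟩ := hP
  rw [← LinearEquiv.toLinearMap_injective ((LinearMap.toMatrix _ _).injective hh)]
  exact hG

end Shear

/-! ### Subgroups generated by the two CNOTs and block-diagonal maps -/

section Blocks

variable {V : Type*} [AddCommGroup V] [Module (ZMod 2) V]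

/-- The block-diagonal map `diag(1, h)`. -/
def secondBlock (h : V ≃ₗ[ZMod 2] V) : (V × V) ≃ₗ[ZMod 2] (V × V) :=
  (LinearEquiv.refl (ZMod 2) V).prodCongr h

/-- The shear by `1 + a` is the commutator of a CNOT, which is an involution, and `diag(a, 1)`. -/
theorem lowerShear_one_add_mem {G : Subgroup ((V × V) ≃ₗ[ZMod 2] (V × V))}
    (h12 : cnot₁₂ V ∈ G) {a : V ≃ₗ[ZMod 2] V} (ha : firstBlock V a ∈ G) :
    lowerShear (1 + a.toLinearMap) ∈ G := by
  have : lowerShear (1 + a.toLinearMap) =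
      cnot₁₂ V * (firstBlock V a)⁻¹ * cnot₁₂ V * firstBlock V a := by
    rw [← map_inv]
    ext p
    · exact (a.symm_apply_apply p.1).symm
    · change p.2 + (p.1 + a p.1) = a.symm (a p.1) + (a p.1 + p.2)
      rw [a.symm_apply_apply]
      abel
  rw [this]
  exact G.mul_mem (G.mul_mem (G.mul_mem h12 (G.inv_mem ha)) h12) ha

theorem lowerShear_mul_mem {G : Subgroup ((V × V) ≃ₗ[ZMod 2] (V × V))} {a : V ≃ₗ[ZMod 2] V}
    (ha : secondBlock a ∈ G) {m : Module.End (ZMod 2) V} (hm : lowerShear m ∈ G) :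
    lowerShear (a.toLinearMap * m) ∈ G := by
  have : lowerShear (a.toLinearMap * m) = secondBlock a * lowerShear m * (secondBlock a)⁻¹ := by
    rw [eq_mul_inv_iff_mul_eq]
    ext p
    · rfl
    · exact (map_add a p.2 (m p.1)).symm
  rw [this]
  exact G.mul_mem (G.mul_mem ha hm) (G.inv_mem ha)

theorem lowerShear_mul_mem' {G : Subgroup ((V × V) ≃ₗ[ZMod 2] (V × V))} {a : V ≃ₗ[ZMod 2] V}
    (ha : firstBlock V a ∈ G) {m : Module.End (ZMod 2) V} (hm : lowerShear m ∈ G) :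
    lowerShear (m * a.toLinearMap) ∈ G := by
  have : lowerShear (m * a.toLinearMap) = (firstBlock V a)⁻¹ * lowerShear m * firstBlock V a := by
    rw [mul_assoc, eq_inv_mul_iff_mul_eq]
    ext p <;> rfl
  rw [this]
  exact G.mul_mem (G.mul_mem (G.inv_mem ha) hm) ha

theorem lowerShear_add (m n : Module.End (ZMod 2) V) :
    lowerShear (m + n) = lowerShear m * lowerShear n := by
  ext p
  · rfl
  · change p.2 + (m p.1 + n p.1) = p.2 + n p.1 + m p.1
    abel

theorem lowerShear_zero : lowerShear (0 : Module.End (ZMod 2) V) = 1 := by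
  ext p
  · rfl
  · exact add_zero p.2

theorem lowerShear_neg (m : Module.End (ZMod 2) V) :
    lowerShear (-m) = (lowerShear m)⁻¹ := by
  rw [eq_inv_iff_mul_eq_one, ← lowerShear_add, neg_add_cancel, lowerShear_zero]

/-- The product of three CNOTs is the swap of the two blocks; it exchanges upper and lower
shears. -/
theorem upperShear_mem {G : Subgroup ((V × V) ≃ₗ[ZMod 2] (V × V))}
    (h12 : cnot₁₂ V ∈ G) (h21 : cnot₂₁ V ∈ G) {m : Module.End (ZMod 2) V}
    (hm : lowerShear m ∈ G) : upperShear m ∈ G := by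
  set s := cnot₁₂ V * cnot₂₁ V * cnot₁₂ V with hs
  have hsG : s ∈ G := G.mul_mem (G.mul_mem h12 h21) h12
  have hswap (p : V × V) : s p = (p.2, p.1) := by
    change (p.1 + (p.1 + p.2), (p.1 + (p.1 + p.2)) + (p.1 + p.2)) = (p.2, p.1)
    have h := add_self_eq_zero_of_zmod2 p.1
    have h' := add_self_eq_zero_of_zmod2 p.2
    rw [← add_assoc, h, zero_add, add_comm p.1, ← add_assoc, h', zero_add]
  have : upperShear m = s * lowerShear m * s := by
    refine LinearEquiv.ext fun p => ?_
    change _ = s (lowerShear m (s p))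
    rw [hswap, hswap]
    rfl
  rw [this]
  exact G.mul_mem (G.mul_mem hsG hm) hsG

end Blocks

/-- The automorphisms in `A` have an augmentation ideal that is all of `End W`: an additive group of
endomorphisms that contains `1 + a` for all `a ∈ A` and is stable under left and right
multiplication by `A` contains everything. -/
def AugmentationFull {W : Type*} [AddCommGroup W] [Module (ZMod 2) W]
    (A : Set (W ≃ₗ[ZMod 2] W)) : Prop :=
  ∀ I : AddSubgroup (Module.End (ZMod 2) W), (∀ a ∈ A, 1 + a.toLinearMap ∈ I) →
    (∀ a ∈ A, ∀ m ∈ I, a.toLinearMap * m ∈ I) → (∀ a ∈ A, ∀ m ∈ I, m * a.toLinearMap ∈ I) →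
    I = ⊤

section Embedding

variable {W T V : Type*} [AddCommGroup W] [Module (ZMod 2) W] [AddCommGroup T]
  [Module (ZMod 2) T] [AddCommGroup V] [Module (ZMod 2) V]

/-- The automorphism of `V ≃ W × T` that acts as `a` on `W` and trivially on `T`. -/
def extendAut (Φ : (W × T) ≃ₗ[ZMod 2] V) (a : W ≃ₗ[ZMod 2] W) : V ≃ₗ[ZMod 2] V :=
  Φ.symm.trans ((a.prodCongr (LinearEquiv.refl (ZMod 2) T)).trans Φ)

theorem extendAut_apply (Φ : (W × T) ≃ₗ[ZMod 2] V) (a : W ≃ₗ[ZMod 2] W) (w : W) (t : T) :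
    extendAut Φ a (Φ (w, t)) = Φ (a w, t) := by
  simp [extendAut]

/-- Two copies of `V ≃ W × T` are two copies of `W` together with two copies of `T`. -/
def twoCopies (Φ : (W × T) ≃ₗ[ZMod 2] V) :
    ((W × W) × (T × T)) ≃ₗ[ZMod 2] (V × V) :=
  (LinearEquiv.prodProdProdComm (ZMod 2) W W T T).trans (Φ.prodCongr Φ)

theorem twoCopies_apply (Φ : (W × T) ≃ₗ[ZMod 2] V) (p : (W × W) × (T × T)) :
    twoCopies Φ p = (Φ (p.1.1, p.2.1), Φ (p.1.2, p.2.2)) := rfl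

/-- The action of `GL(W × W) × GL(T × T)` on two copies of `V ≃ W × T`. -/
def blockEmb (Φ : (W × T) ≃ₗ[ZMod 2] V) :
    ((W × W) ≃ₗ[ZMod 2] (W × W)) × ((T × T) ≃ₗ[ZMod 2] (T × T)) →*
      ((V × V) ≃ₗ[ZMod 2] (V × V)) where
  toFun q := (twoCopies Φ).symm.trans ((q.1.prodCongr q.2).trans (twoCopies Φ))
  map_one' := LinearEquiv.ext fun p => (twoCopies Φ).apply_symm_apply p
  map_mul' q r := by
    refine LinearEquiv.ext fun p => ?_
    change _ = twoCopies Φ ((q.1.prodCongr q.2) ((twoCopies Φ).symm (twoCopies Φ _)))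
    rw [(twoCopies Φ).symm_apply_apply]
    rfl

theorem blockEmb_twoCopies (Φ : (W × T) ≃ₗ[ZMod 2] V) (g : (W × W) ≃ₗ[ZMod 2] (W × W))
    (h : (T × T) ≃ₗ[ZMod 2] (T × T)) (p : (W × W) × (T × T)) :
    blockEmb Φ (g, h) (twoCopies Φ p) = twoCopies Φ (g p.1, h p.2) := by
  change twoCopies Φ ((g.prodCongr h) ((twoCopies Φ).symm (twoCopies Φ p))) = _
  rw [(twoCopies Φ).symm_apply_apply]
  rfl

theorem blockEmb_eq_iff (Φ : (W × T) ≃ₗ[ZMod 2] V) (g : (W × W) ≃ₗ[ZMod 2] (W × W))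
    (h : (T × T) ≃ₗ[ZMod 2] (T × T)) (f : (V × V) ≃ₗ[ZMod 2] (V × V)) :
    blockEmb Φ (g, h) = f ↔ ∀ p, twoCopies Φ (g p.1, h p.2) = f (twoCopies Φ p) := by
  constructor
  · rintro rfl p
    rw [blockEmb_twoCopies]
  · intro H
    refine LinearEquiv.ext fun x => ?_
    obtain ⟨p, rfl⟩ := (twoCopies Φ).surjective x
    rw [blockEmb_twoCopies, H]

theorem blockEmb_injective (Φ : (W × T) ≃ₗ[ZMod 2] V) : Function.Injective (blockEmb Φ) := by
  rintro ⟨g, h⟩ ⟨g', h'⟩ H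
  rw [blockEmb_eq_iff] at H
  have H' (p : (W × W) × (T × T)) : (g p.1, h p.2) = (g' p.1, h' p.2) :=
    (twoCopies Φ).injective ((H p).trans (blockEmb_twoCopies Φ g' h' p))
  refine Prod.ext (LinearEquiv.ext fun x => ?_) (LinearEquiv.ext fun x => ?_)
  · exact congrArg Prod.fst (H' (x, 0))
  · exact congrArg Prod.snd (H' (0, x))

theorem blockEmb_cnot₁₂ (Φ : (W × T) ≃ₗ[ZMod 2] V) :
    blockEmb Φ (cnot₁₂ W, cnot₁₂ T) = cnot₁₂ V := by
  rw [blockEmb_eq_iff]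
  intro p
  rw [twoCopies_apply, twoCopies_apply, cnot₁₂_apply (V := V), ← map_add]
  rfl

theorem blockEmb_cnot₂₁ (Φ : (W × T) ≃ₗ[ZMod 2] V) :
    blockEmb Φ (cnot₂₁ W, cnot₂₁ T) = cnot₂₁ V := by
  rw [blockEmb_eq_iff]
  intro p
  rw [twoCopies_apply, twoCopies_apply, cnot₂₁_apply (V := V), ← map_add]
  rfl

theorem blockEmb_prodCongr (Φ : (W × T) ≃ₗ[ZMod 2] V) (a b : W ≃ₗ[ZMod 2] W) :
    blockEmb Φ (a.prodCongr b, 1) = (extendAut Φ a).prodCongr (extendAut Φ b) := by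
  rw [blockEmb_eq_iff]
  intro p
  rw [twoCopies_apply, twoCopies_apply]
  exact Prod.ext (extendAut_apply Φ a _ _).symm (extendAut_apply Φ b _ _).symm

/-- The endomorphism of `V ≃ W × T` that acts as `m` on `W` and as zero on `T`. -/
def extendEnd (Φ : (W × T) ≃ₗ[ZMod 2] V) :
    Module.End (ZMod 2) W →+ Module.End (ZMod 2) V where
  toFun m := Φ.toLinearMap ∘ₗ (LinearMap.inl (ZMod 2) W T ∘ₗ m ∘ₗ LinearMap.fst (ZMod 2) W T) ∘ₗ
    Φ.symm.toLinearMap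
  map_zero' := by ext; simp
  map_add' m n := by
    ext x
    simp [← map_add]

theorem extendEnd_apply (Φ : (W × T) ≃ₗ[ZMod 2] V) (m : Module.End (ZMod 2) W) (w : W) (t : T) :
    extendEnd Φ m (Φ (w, t)) = Φ (m w, 0) := by
  simp [extendEnd]

theorem blockEmb_lowerShear (Φ : (W × T) ≃ₗ[ZMod 2] V) (m : Module.End (ZMod 2) W) :
    blockEmb Φ (lowerShear m, 1) = lowerShear (extendEnd Φ m) := by
  rw [blockEmb_eq_iff]
  intro p
  rw [lowerShear_apply, lowerShear_apply, twoCopies_apply, twoCopies_apply, extendEnd_apply,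
    ← map_add, Prod.mk_add_mk, add_zero]
  rfl

theorem blockEmb_upperShear (Φ : (W × T) ≃ₗ[ZMod 2] V) (m : Module.End (ZMod 2) W) :
    blockEmb Φ (upperShear m, 1) = upperShear (extendEnd Φ m) := by
  rw [blockEmb_eq_iff]
  intro p
  rw [upperShear_apply, upperShear_apply, twoCopies_apply, twoCopies_apply, extendEnd_apply,
    ← map_add, Prod.mk_add_mk, add_zero]
  rfl

/-- If a group of automorphisms of two copies of `V ≃ W × T` contains the CNOTs and the
block-diagonal maps from a set of automorphisms of `W` whose augmentation ideal is full, then it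
contains all of `GL(W × W)`. The maps `m` for which the shear by `m` lies in the group are an
additive group to which the fullness applies, and the shears generate. -/
theorem blockEmb_mem [FiniteDimensional (ZMod 2) W] (Φ : (W × T) ≃ₗ[ZMod 2] V)
    {G : Subgroup ((V × V) ≃ₗ[ZMod 2] (V × V))} (h12 : cnot₁₂ V ∈ G) (h21 : cnot₂₁ V ∈ G)
    {A : Set (W ≃ₗ[ZMod 2] W)} (hA : AugmentationFull A)
    (hfst : ∀ a ∈ A, firstBlock V (extendAut Φ a) ∈ G)
    (hsnd : ∀ a ∈ A, secondBlock (extendAut Φ a) ∈ G) (g : (W × W) ≃ₗ[ZMod 2] (W × W)) :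
    blockEmb Φ (g, 1) ∈ G := by
  let I : AddSubgroup (Module.End (ZMod 2) W) :=
    { carrier := {m | lowerShear (extendEnd Φ m) ∈ G}
      add_mem' := by
        intro m n hm hn
        change lowerShear _ ∈ G
        rw [map_add, lowerShear_add]
        exact G.mul_mem hm hn
      zero_mem' := by
        change lowerShear _ ∈ G
        rw [map_zero, lowerShear_zero]
        exact G.one_mem
      neg_mem' := by
        intro m hm
        change lowerShear _ ∈ G
        rw [map_neg, lowerShear_neg]
        exact G.inv_mem hm }
  have hext {m n : Module.End (ZMod 2) V} (h : ∀ w t, m (Φ (w, t)) = n (Φ (w, t))) : m = n := by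
    ext x
    obtain ⟨⟨w, t⟩, rfl⟩ := Φ.surjective x
    exact h w t
  have hI : I = ⊤ := by
    apply hA
    · intro a ha
      have : extendEnd Φ (1 + a.toLinearMap) = 1 + (extendAut Φ a).toLinearMap := by
        refine hext fun w t => ?_
        rw [extendEnd_apply]
        change _ = Φ (w, t) + extendAut Φ a (Φ (w, t))
        rw [extendAut_apply, ← map_add, Prod.mk_add_mk, add_self_eq_zero_of_zmod2]
        rfl
      change lowerShear _ ∈ G
      rw [this]
      exact lowerShear_one_add_mem h12 (hfst a ha)
    · intro a ha m hm
      have : extendEnd Φ (a.toLinearMap * m) =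
          (extendAut Φ a).toLinearMap * extendEnd Φ m := by
        refine hext fun w t => ?_
        rw [extendEnd_apply]
        change _ = extendAut Φ a (extendEnd Φ m (Φ (w, t)))
        rw [extendEnd_apply, extendAut_apply]
        rfl
      change lowerShear _ ∈ G
      rw [this]
      exact lowerShear_mul_mem (hsnd a ha) hm
    · intro a ha m hm
      have : extendEnd Φ (m * a.toLinearMap) =
          extendEnd Φ m * (extendAut Φ a).toLinearMap := by
        refine hext fun w t => ?_
        rw [extendEnd_apply]
        change _ = extendEnd Φ m (extendAut Φ a (Φ (w, t)))
        rw [extendAut_apply, extendEnd_apply]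
        rfl
      change lowerShear _ ∈ G
      rw [this]
      exact lowerShear_mul_mem' (hfst a ha) hm
  have hlow (m) : lowerShear (extendEnd Φ m) ∈ G := by
    have : m ∈ I := hI ▸ AddSubgroup.mem_top m
    exact this
  let K : Subgroup ((W × W) ≃ₗ[ZMod 2] (W × W)) :=
    G.comap ((blockEmb Φ).comp (MonoidHom.inl _ _))
  have hK : K = ⊤ := by
    apply eq_top_of_shears_mem
    · intro m
      change blockEmb Φ (lowerShear m, 1) ∈ G
      rw [blockEmb_lowerShear]
      exact hlow m
    · intro m
      change blockEmb Φ (upperShear m, 1) ∈ G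
      rw [blockEmb_upperShear]
      exact upperShear_mem h12 h21 (hlow m)
  have : g ∈ K := hK ▸ Subgroup.mem_top g
  exact this

end Embedding

/-- The two CNOTs generate the linear group of two copies of `𝔽₂`: they are its shears. -/
theorem eq_top_of_cnot_mem {G : Subgroup ((ZMod 2 × ZMod 2) ≃ₗ[ZMod 2] (ZMod 2 × ZMod 2))}
    (h12 : cnot₁₂ (ZMod 2) ∈ G) (h21 : cnot₂₁ (ZMod 2) ∈ G) : G = ⊤ := by
  have hm (m : Module.End (ZMod 2) (ZMod 2)) : m = 0 ∨ m = 1 := by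
    rcases zmod2_cases (m 1) with h | h
    · left
      ext
      exact h
    · right
      ext
      exact h
  have hlow (m) : lowerShear m ∈ G := by
    rcases hm m with rfl | rfl
    · rw [lowerShear_zero]
      exact G.one_mem
    · convert h12 using 1
      refine LinearEquiv.ext fun p => ?_
      rw [lowerShear_apply, cnot₁₂_apply, add_comm]
      rfl
  exact eq_top_of_shears_mem G hlow fun m => upperShear_mem h12 h21 (hlow m)

/-! ### The states of a CSS code -/

section States

variable {n : ℕ} {C C₁ C₂ : Submodule (ZMod 2) (Word n)}

open Classical in
theorem cosetState_apply (C : Submodule (ZMod 2) (Word n)) (v w : Word n) :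
    cosetState C v w = if w - v ∈ C then (1 / (Real.sqrt (Nat.card C) : ℂ)) else 0 := by
  have h : (∑ c : Word n with c ∈ C, EuclideanSpace.single (c + v) (1 : ℂ)) w =
      if w - v ∈ C then (1 : ℂ) else 0 := by
    rw [WithLp.ofLp_sum, Finset.sum_apply, Finset.sum_filter, Finset.sum_eq_single (w - v)]
    · simp
    · intro c _ hc
      have : w ≠ c + v := fun h => hc (by rw [h, add_sub_cancel_right])
      simp [this]
    · simp
  unfold cosetState
  rw [PiLp.smul_apply, h]
  simp

theorem cosetState_eq_of_sub_mem {u v : Word n} (h : u - v ∈ C) :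
    cosetState C u = cosetState C v := by
  classical
  ext w
  have : w - u ∈ C ↔ w - v ∈ C := by
    rw [← C.add_mem_iff_left h, sub_add_sub_cancel]
  rw [cosetState_apply, cosetState_apply, if_congr this rfl rfl]

theorem inner_block (φ ψ : Block n) :
    inner ℂ φ ψ = ∑ w, starRingEnd ℂ (φ w) * ψ w := by
  rw [PiLp.inner_apply]
  refine Finset.sum_congr rfl fun w _ => ?_
  rw [RCLike.inner_apply, mul_comm]

theorem inner_cosetState_self (v : Word n) :
    inner ℂ (cosetState C v) (cosetState C v) = (1 : ℂ) := by
  classical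
  have hcard : (Finset.univ.filter fun w : Word n => w - v ∈ C).card = Nat.card C := by
    rw [Nat.card_eq_fintype_card, Fintype.card_subtype]
    refine Finset.card_bij (fun w _ => w - v) ?_ ?_ ?_
    · intro w hw
      simpa using hw
    · intro w _ w' _ h
      exact sub_left_injective h
    · intro c hc
      exact ⟨c + v, by simpa using hc, add_sub_cancel_right c v⟩
  have hpos : (0 : ℝ) < Nat.card C := by exact_mod_cast Nat.card_pos
  rw [inner_block]
  simp_rw [cosetState_apply]
  have hterm (w : Word n) : starRingEnd ℂ (if w - v ∈ C then
        (1 / (Real.sqrt (Nat.card C) : ℂ)) else 0) *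
      (if w - v ∈ C then (1 / (Real.sqrt (Nat.card C) : ℂ)) else 0) =
      if w - v ∈ C then (1 / (Nat.card C : ℂ)) else 0 := by
    split_ifs
    · rw [map_div₀, map_one, Complex.conj_ofReal, div_mul_div_comm, one_mul,
        ← Complex.ofReal_mul, Real.mul_self_sqrt hpos.le, Complex.ofReal_natCast]
    · simp
  simp_rw [hterm]
  rw [← Finset.sum_filter, Finset.sum_const, hcard, nsmul_eq_mul, mul_one_div, div_self]
  exact_mod_cast hpos.ne'

theorem norm_cosetState (v : Word n) : ‖cosetState C v‖ = 1 := by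
  rw [norm_eq_sqrt_re_inner (𝕜 := ℂ), inner_cosetState_self]
  simp

theorem inner_cosetState_of_sub_notMem {u v : Word n} (h : u - v ∉ C) :
    inner ℂ (cosetState C u) (cosetState C v) = (0 : ℂ) := by
  rw [inner_block]
  refine Finset.sum_eq_zero fun w _ => ?_
  rw [cosetState_apply, cosetState_apply]
  by_cases hu : w - u ∈ C
  · have hv : w - v ∉ C := fun hv => h (by
      have := C.sub_mem hv hu
      rwa [sub_sub_sub_cancel_left] at this)
    rw [if_neg hv, mul_zero]
  · rw [if_neg hu, map_zero, zero_mul]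

theorem cosetState_mem_codeSpace {v : Word n} (hv : v ∈ C₁) :
    cosetState C₂ v ∈ codeSpace C₁ C₂ :=
  Submodule.subset_span ⟨v, hv, rfl⟩

theorem codeSpace_mono {D : Submodule (ZMod 2) (Word n)} (h : D ≤ C₁) :
    codeSpace D C₂ ≤ codeSpace C₁ C₂ :=
  Submodule.span_mono (Set.image_mono h)

/-- The states of the different cosets form an orthonormal basis of the CSS code. -/
theorem finrank_codeSpace (C₁ C₂ : Submodule (ZMod 2) (Word n)) :
    Module.finrank ℂ (codeSpace C₁ C₂) = 2 ^ Module.finrank (ZMod 2) (Logical C₁ C₂) := by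
  classical
  let f : Logical C₁ C₂ → Block n := fun q => cosetState C₂ (q.out : C₁)
  have hf : Orthonormal ℂ f := by
    refine ⟨fun q => ?_, fun q r hqr => ?_⟩
    · exact norm_cosetState _
    · refine inner_cosetState_of_sub_notMem fun h => hqr ?_
      have h' : (q.out - r.out : C₁) ∈ C₂.submoduleOf C₁ := h
      rw [← Submodule.Quotient.eq] at h'
      have hq : (Submodule.Quotient.mk q.out : Logical C₁ C₂) = q := Quotient.out_eq q
      have hr : (Submodule.Quotient.mk r.out : Logical C₁ C₂) = r := Quotient.out_eq r
      rw [← hq, ← hr, h']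
  have hspan : codeSpace C₁ C₂ = Submodule.span ℂ (Set.range f) := by
    unfold codeSpace
    congr 1
    ext φ
    constructor
    · rintro ⟨v, hv, rfl⟩
      refine ⟨coset C₁ C₂ ⟨v, hv⟩, cosetState_eq_of_sub_mem ?_⟩
      exact (Submodule.Quotient.eq (C₂.submoduleOf C₁)).1
        (Quotient.out_eq (coset C₁ C₂ ⟨v, hv⟩))
    · rintro ⟨q, rfl⟩
      exact ⟨_, (q.out : C₁).2, rfl⟩
  have : Fintype (Logical C₁ C₂) := Fintype.ofFinite _
  rw [hspan, finrank_span_eq_card hf.linearIndependent,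
    Module.card_eq_pow_finrank (K := ZMod 2), ZMod.card]

end States

/-! ### Pauli errors -/

section Pauli

variable {n : ℕ} {C₁ C₂ : Submodule (ZMod 2) (Word n)}

theorem pauli_apply (a b : Word n) (φ : Block n) (w : Word n) :
    pauli a b φ w = (if b ⬝ᵥ (w - a) = 0 then 1 else -1) * φ (w - a) := rfl

theorem pauli_add (a b : Word n) (φ ψ : Block n) :
    pauli a b (φ + ψ) = pauli a b φ + pauli a b ψ := by
  ext w
  simp only [pauli_apply, PiLp.add_apply, mul_add]

theorem pauli_smul (a b : Word n) (c : ℂ) (φ : Block n) :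
    pauli a b (c • φ) = c • pauli a b φ := by
  ext w
  simp only [pauli_apply, PiLp.smul_apply, smul_eq_mul]
  ring

theorem pauli_zero_zero (φ : Block n) : pauli 0 0 φ = φ := by
  ext w
  simp [pauli_apply]

theorem pauli_cosetState (C : Submodule (ZMod 2) (Word n)) (a v : Word n) :
    pauli a 0 (cosetState C v) = cosetState C (v + a) := by
  ext w
  rw [pauli_apply, zero_dotProduct, if_pos rfl, one_mul, cosetState_apply, cosetState_apply,
    sub_sub, add_comm a v]

/-- To detect an error on a CSS code it suffices to look at the states of the cosets. -/
theorem detects_of_cosetState {a b : Word n} (μ : ℂ)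
    (h : ∀ u ∈ C₁, ∀ v ∈ C₁, inner ℂ (cosetState C₂ u) (pauli a b (cosetState C₂ v)) =
      μ * inner ℂ (cosetState C₂ u) (cosetState C₂ v)) :
    Detects (codeSpace C₁ C₂) a b := by
  refine ⟨μ, fun φ hφ ψ hψ => ?_⟩
  induction hψ using Submodule.span_induction with
  | mem ψ hψ =>
    obtain ⟨v, hv, rfl⟩ := hψ
    induction hφ using Submodule.span_induction with
    | mem φ hφ =>
      obtain ⟨u, hu, rfl⟩ := hφ
      exact h u hu v hv
    | zero => simp
    | add x y _ _ hx hy => rw [inner_add_left, inner_add_left, hx, hy, mul_add]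
    | smul c x _ hx =>
      rw [inner_smul_left, inner_smul_left, hx]
      ring
  | zero =>
    have : pauli a b (0 : Block n) = 0 := by
      simpa using pauli_smul a b 0 (0 : Block n)
    rw [this]
    simp
  | add x y _ _ hx hy => rw [pauli_add, inner_add_right, inner_add_right, hx, hy, mul_add]
  | smul c x _ hx =>
    rw [pauli_smul, inner_smul_right, inner_smul_right, hx]
    ring

/-- An error with `a ∉ C₁` moves the code to an orthogonal space. -/
theorem detects_of_notMem (hle : C₂ ≤ C₁) {a b : Word n} (ha : a ∉ C₁) :
    Detects (codeSpace C₁ C₂) a b := by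
  refine detects_of_cosetState 0 fun u hu v hv => ?_
  rw [zero_mul, inner_block]
  refine Finset.sum_eq_zero fun w _ => ?_
  rw [pauli_apply, cosetState_apply, cosetState_apply]
  by_cases hw : w - u ∈ C₂
  · have : w - a - v ∉ C₂ := fun h => ha (by
      have h1 := C₁.sub_mem (C₁.sub_mem (hle hw) (hle h)) (C₁.sub_mem hv hu)
      rwa [show w - u - (w - a - v) - (v - u) = a by abel] at h1)
    rw [if_neg this, mul_zero, mul_zero]
  · rw [if_neg hw, map_zero, zero_mul]

/-- A phase error that is not constant on the cosets of `C₂` cancels in every inner product. -/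
theorem detects_of_notMem_dualCode {b : Word n} (hb : b ∉ dualCode C₂) :
    Detects (codeSpace C₁ C₂) 0 b := by
  have : ∃ c ∈ C₂, c ⬝ᵥ b ≠ 0 := by
    by_contra! h
    exact hb h
  obtain ⟨c, hc, hcb⟩ := this
  have hcb1 : b ⬝ᵥ c = 1 := by
    rw [dotProduct_comm]
    exact zmod2_eq_one hcb
  have hshift (x w : Word n) : cosetState C₂ x (w + c) = cosetState C₂ x w := by
    classical
    have : w + c - x ∈ C₂ ↔ w - x ∈ C₂ := by
      rw [add_sub_right_comm, C₂.add_mem_iff_left hc]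
    rw [cosetState_apply, cosetState_apply, if_congr this rfl rfl]
  refine detects_of_cosetState 0 fun u _ v _ => ?_
  rw [zero_mul, ← self_eq_neg, inner_block, ← Finset.sum_neg_distrib]
  -- translation by `c` permutes the terms and changes all signs
  refine Fintype.sum_equiv (Equiv.addRight c) _ _ fun w => ?_
  rw [Equiv.coe_addRight, pauli_apply, pauli_apply, sub_zero, sub_zero, hshift, hshift,
    dotProduct_add, hcb1]
  rcases zmod2_cases (b ⬝ᵥ w) with h | h <;> rw [h]
  · simp
  · simp [show (1 + 1 : ZMod 2) = 0 from rfl]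

/-- A phase error that is constant on the cosets of `C₂` but not trivial on `C₁` acts as a
nontrivial diagonal operator on the code. -/
theorem not_detects {b : Word n} (hb : b ∈ dualCode C₂) (hb' : b ∉ dualCode C₁) :
    ¬ Detects (codeSpace C₁ C₂) 0 b := by
  have : ∃ c ∈ C₁, c ⬝ᵥ b ≠ 0 := by
    by_contra! h
    exact hb' h
  obtain ⟨c, hc, hcb⟩ := this
  have hcb1 : b ⬝ᵥ c = 1 := by
    rw [dotProduct_comm]
    exact zmod2_eq_one hcb
  have key (v : Word n) : pauli 0 b (cosetState C₂ v) =
      (if b ⬝ᵥ v = 0 then (1 : ℂ) else -1) • cosetState C₂ v := by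
    ext w
    rw [pauli_apply, PiLp.smul_apply, smul_eq_mul, sub_zero, cosetState_apply]
    by_cases hw : w - v ∈ C₂
    · have h := hb _ hw
      rw [dotProduct_comm, dotProduct_sub, sub_eq_zero] at h
      rw [h]
    · rw [if_neg hw, mul_zero, mul_zero]
  rintro ⟨μ, h⟩
  have h0 := h _ (cosetState_mem_codeSpace C₁.zero_mem) _ (cosetState_mem_codeSpace C₁.zero_mem)
  have h1 := h _ (cosetState_mem_codeSpace hc) _ (cosetState_mem_codeSpace hc)
  rw [key, inner_smul_right, inner_cosetState_self, dotProduct_zero, if_pos rfl, mul_one,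
    mul_one] at h0
  rw [key, inner_smul_right, inner_cosetState_self, hcb1, if_neg one_ne_zero, mul_one,
    mul_one, ← h0] at h1
  norm_num at h1

theorem hammingNorm_le_pauliWeight_left (a b : Word n) : hammingNorm a ≤ pauliWeight a b :=
  Finset.card_le_card fun i hi => by
    rw [Finset.mem_filter] at hi ⊢
    exact ⟨hi.1, Or.inl hi.2⟩

theorem hammingNorm_le_pauliWeight_right (a b : Word n) : hammingNorm b ≤ pauliWeight a b :=
  Finset.card_le_card fun i hi => by
    rw [Finset.mem_filter] at hi ⊢
    exact ⟨hi.1, Or.inr hi.2⟩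

/-- The parameters of a CSS code, from the weights in `C₁` and in the dual of `C₂`, when the
minimum is attained by a phase error. -/
theorem isQuantumCode {k d : ℕ} (hle : C₂ ≤ C₁)
    (hk : Module.finrank (ZMod 2) (Logical C₁ C₂) = k)
    (h₁ : ∀ c ∈ C₁, c ≠ 0 → d ≤ hammingNorm c)
    (h₂ : ∀ c ∈ dualCode C₂, c ≠ 0 → d ≤ hammingNorm c)
    (hd : ∃ b ∈ dualCode C₂, b ∉ dualCode C₁ ∧ hammingNorm b = d) :
    IsQuantumCode (codeSpace C₁ C₂) k d := by
  refine ⟨by rw [finrank_codeSpace, hk], ?_, ?_⟩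
  · obtain ⟨b, hb, hb', rfl⟩ := hd
    refine ⟨0, b, not_detects hb hb', ?_⟩
    simp [pauliWeight, hammingNorm]
  · rintro w ⟨a, b, hab, rfl⟩
    by_contra! hw
    apply hab
    by_cases ha : a ∈ C₁
    · have ha0 : a = 0 := by
        by_contra h0
        exact (h₁ a ha h0).not_gt ((hammingNorm_le_pauliWeight_left a b).trans_lt hw)
      subst ha0
      by_cases hb : b ∈ dualCode C₂
      · have hb0 : b = 0 := by
          by_contra h0
          exact (h₂ b hb h0).not_gt ((hammingNorm_le_pauliWeight_right 0 b).trans_lt hw)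
        subst hb0
        refine ⟨1, fun φ _ ψ _ => ?_⟩
        rw [pauli_zero_zero, one_mul]
      · exact detects_of_notMem_dualCode hb
    · exact detects_of_notMem hle ha

theorem permuteQubits_pauli_one (π : Equiv.Perm (Fin n)) (φ : Block n) :
    permuteQubits π (pauli 1 0 φ) = pauli 1 0 (permuteQubits π φ) := by
  have h (φ : Block n) (w : Word n) :
      permuteQubits π φ w = φ ((permWord π).symm w) := rfl
  ext w
  rw [h, pauli_apply, pauli_apply, zero_dotProduct, zero_dotProduct, h, map_sub]
  rfl

end Pauli

/-! ### Realization of linear transformations of the labels -/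

section Realization

variable {n : ℕ} {C₁ C₂ : Submodule (ZMod 2) (Word n)}

theorem tensor_cosetState_apply (C : Submodule (ZMod 2) (Word n)) (u v : Word n)
    (w : Word n × Word n) [Decidable (w - (u, v) ∈ C.prod C)] :
    tensor (cosetState C u) (cosetState C v) w = if w - (u, v) ∈ C.prod C then
      (1 / (Real.sqrt (Nat.card C) : ℂ)) * (1 / (Real.sqrt (Nat.card C) : ℂ)) else 0 := by
  classical
  change cosetState C u w.1 * cosetState C v w.2 = _
  rw [cosetState_apply, cosetState_apply]
  have : w - (u, v) ∈ C.prod C ↔ w.1 - u ∈ C ∧ w.2 - v ∈ C := Iff.rfl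
  rw [if_congr this rfl rfl]
  split_ifs <;> simp_all

/-- A linear permutation of the computational basis that preserves `C₂ × C₂` realizes the map that
it induces on cosets. -/
theorem realizes_basisUnitary (f : (Word n × Word n) ≃ₗ[ZMod 2] (Word n × Word n))
    {g : (Logical C₁ C₂ × Logical C₁ C₂) ≃ₗ[ZMod 2] (Logical C₁ C₂ × Logical C₁ C₂)}
    (hf : ∀ p, p ∈ C₂.prod C₂ ↔ f p ∈ C₂.prod C₂)
    (hfg : ∀ u v u' v' : C₁, g (coset C₁ C₂ u, coset C₁ C₂ v) =
      (coset C₁ C₂ u', coset C₁ C₂ v') →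
      f ((u : Word n), (v : Word n)) - ((u' : Word n), (v' : Word n)) ∈ C₂.prod C₂) :
    Realizes C₁ C₂ (basisUnitary f.toEquiv) g := by
  classical
  intro u v u' v' h
  ext w
  change tensor (cosetState C₂ u) (cosetState C₂ v) (f.symm w) = _
  rw [tensor_cosetState_apply, tensor_cosetState_apply]
  refine if_congr ?_ rfl rfl
  rw [hf, map_sub, LinearEquiv.apply_symm_apply, ← Submodule.add_mem_iff_left _ (hfg u v u' v' h),
    sub_add_sub_cancel]

theorem coset_eq_iff {u v : C₁} :
    coset C₁ C₂ u = coset C₁ C₂ v ↔ (u : Word n) - (v : Word n) ∈ C₂ :=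
  Submodule.Quotient.eq (C₂.submoduleOf C₁)

theorem realizes_cnot₁₂ :
    Realizes C₁ C₂ (basisUnitary (cnot₁₂ (Word n)).toEquiv) (cnot₁₂ (Logical C₁ C₂)) := by
  apply realizes_basisUnitary
  · rintro ⟨x, y⟩
    rw [cnot₁₂_apply, Submodule.mem_prod, Submodule.mem_prod]
    exact and_congr_right fun hx => (C₂.add_mem_iff_right hx).symm
  · intro u v u' v' h
    rw [cnot₁₂_apply, Prod.mk.injEq] at h
    exact ⟨coset_eq_iff.1 h.1, coset_eq_iff (u := u + v).1 h.2⟩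

theorem realizes_cnot₂₁ :
    Realizes C₁ C₂ (basisUnitary (cnot₂₁ (Word n)).toEquiv) (cnot₂₁ (Logical C₁ C₂)) := by
  apply realizes_basisUnitary
  · rintro ⟨x, y⟩
    rw [cnot₂₁_apply, Submodule.mem_prod, Submodule.mem_prod]
    exact and_congr_left fun hy => (C₂.add_mem_iff_left hy).symm
  · intro u v u' v' h
    rw [cnot₂₁_apply, Prod.mk.injEq] at h
    exact ⟨coset_eq_iff (u := u + v).1 h.1, coset_eq_iff.1 h.2⟩

theorem permWord_mem_iff {C : Submodule (ZMod 2) (Word n)} {π : Equiv.Perm (Fin n)}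
    (hπ : π ∈ permAut C) (x : Word n) : permWord π x ∈ C ↔ x ∈ C := by
  refine ⟨fun h => ?_, hπ x⟩
  rw [← map_permWord hπ] at h
  obtain ⟨y, hy, hyx⟩ := h
  rwa [← (permWord π).injective hyx]

theorem realizes_logicalPerm (π₁ π₂ : jointAut C₁ C₂) :
    Realizes C₁ C₂ (basisUnitary ((permWord π₁.1).prodCongr (permWord π₂.1)).toEquiv)
      ((logicalPerm π₁).prodCongr (logicalPerm π₂)) := by
  apply realizes_basisUnitary
  · rintro ⟨x, y⟩
    exact and_congr (permWord_mem_iff π₁.2.2 x).symm (permWord_mem_iff π₂.2.2 y).symm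
  · intro u v u' v' h
    rw [LinearEquiv.prodCongr_apply, logicalPerm_coset, logicalPerm_coset, Prod.mk.injEq] at h
    exact ⟨coset_eq_iff.1 h.1, coset_eq_iff.1 h.2⟩

theorem Realizes.one : Realizes C₁ C₂ 1 1 := by
  intro u v u' v' h
  obtain ⟨h1, h2⟩ := Prod.mk.inj h
  change tensor (cosetState C₂ u) (cosetState C₂ v) = _
  rw [cosetState_eq_of_sub_mem (coset_eq_iff.1 h1), cosetState_eq_of_sub_mem (coset_eq_iff.1 h2)]

variable {U U' : TwoBlocks n ≃ₗᵢ[ℂ] TwoBlocks n}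
  {g g' : (Logical C₁ C₂ × Logical C₁ C₂) ≃ₗ[ZMod 2] (Logical C₁ C₂ × Logical C₁ C₂)}

theorem Realizes.mul (h : Realizes C₁ C₂ U g) (h' : Realizes C₁ C₂ U' g') :
    Realizes C₁ C₂ (U * U') (g * g') := by
  intro u v u' v' huv
  obtain ⟨x, hx⟩ := Submodule.Quotient.mk_surjective _ (g' (coset C₁ C₂ u, coset C₁ C₂ v)).1
  obtain ⟨y, hy⟩ := Submodule.Quotient.mk_surjective _ (g' (coset C₁ C₂ u, coset C₁ C₂ v)).2
  have hxy : g' (coset C₁ C₂ u, coset C₁ C₂ v) = (coset C₁ C₂ x, coset C₁ C₂ y) :=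
    Prod.ext hx.symm hy.symm
  change U (U' _) = _
  rw [h' u v x y hxy]
  refine h x y u' v' ?_
  rw [← hxy]
  exact huv

theorem Realizes.inv (h : Realizes C₁ C₂ U g) : Realizes C₁ C₂ U⁻¹ g⁻¹ := by
  intro u v u' v' huv
  have : g (coset C₁ C₂ u', coset C₁ C₂ v') = (coset C₁ C₂ u, coset C₁ C₂ v) := by
    rw [← huv]
    exact g.apply_symm_apply _
  rw [← h u' v' u v this]
  exact U.symm_apply_apply _

theorem exists_realizes_of_mem_G12 (hg : g ∈ G12 C₁ C₂) :
    ∃ U ∈ physicalGroup C₁ C₂, Realizes C₁ C₂ U g := by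
  induction hg using Subgroup.closure_induction with
  | mem g hg =>
    rcases hg with (rfl | rfl) | ⟨π₁, π₂, rfl⟩
    · exact ⟨_, Subgroup.subset_closure (Or.inl (Or.inl rfl)), realizes_cnot₁₂⟩
    · exact ⟨_, Subgroup.subset_closure (Or.inl (Or.inr rfl)), realizes_cnot₂₁⟩
    · exact ⟨_, Subgroup.subset_closure (Or.inr ⟨_, π₁.2, _, π₂.2, rfl⟩),
        realizes_logicalPerm π₁ π₂⟩
  | one => exact ⟨1, Subgroup.one_mem _, Realizes.one⟩
  | mul x y _ _ hx hy =>
    obtain ⟨U, hU, h⟩ := hx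
    obtain ⟨U', hU', h'⟩ := hy
    exact ⟨U * U', Subgroup.mul_mem _ hU hU', h.mul h'⟩
  | inv x _ hx =>
    obtain ⟨U, hU, h⟩ := hx
    exact ⟨U⁻¹, Subgroup.inv_mem _ hU, h.inv⟩

theorem exists_realizes_of_mem_physicalGroup (hU : U ∈ physicalGroup C₁ C₂) :
    ∃ g ∈ G12 C₁ C₂, Realizes C₁ C₂ U g := by
  induction hU using Subgroup.closure_induction with
  | mem U hU =>
    rcases hU with (rfl | rfl) | ⟨π₁, h₁, π₂, h₂, rfl⟩
    · exact ⟨_, Subgroup.subset_closure (Or.inl (Or.inl rfl)), realizes_cnot₁₂⟩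
    · exact ⟨_, Subgroup.subset_closure (Or.inl (Or.inr rfl)), realizes_cnot₂₁⟩
    · exact ⟨_, Subgroup.subset_closure (Or.inr ⟨⟨π₁, h₁⟩, ⟨π₂, h₂⟩, rfl⟩),
        realizes_logicalPerm ⟨π₁, h₁⟩ ⟨π₂, h₂⟩⟩
  | one => exact ⟨1, Subgroup.one_mem _, Realizes.one⟩
  | mul x y _ _ hx hy =>
    obtain ⟨g, hg, h⟩ := hx
    obtain ⟨g', hg', h'⟩ := hy
    exact ⟨g * g', Subgroup.mul_mem _ hg hg', h.mul h'⟩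
  | inv x _ hx =>
    obtain ⟨g, hg, h⟩ := hx
    exact ⟨g⁻¹, Subgroup.inv_mem _ hg, h.inv⟩

end Realization

/-! ### Two generators of the group `GL(4,2)` -/

/-- The element of `GL(4,2)` whose action on the logical qubits has the matrix `M₁`. -/
def genA : GL (Fin 4) (ZMod 2) where
  val := !![0, 0, 0, 1; 0, 0, 1, 0; 0, 1, 0, 1; 1, 0, 1, 0]
  inv := !![0, 1, 0, 1; 1, 0, 1, 0; 0, 1, 0, 0; 1, 0, 0, 0]
  val_inv := by decide
  inv_val := by decide

/-- The element of `GL(4,2)` whose action on the logical qubits has the matrix `M₂`. -/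
def genB : GL (Fin 4) (ZMod 2) where
  val := !![0, 0, 0, 1; 1, 0, 0, 1; 0, 1, 1, 0; 1, 1, 0, 1]
  inv := !![1, 1, 0, 0; 0, 1, 0, 1; 0, 1, 1, 1; 1, 0, 0, 0]
  val_inv := by decide
  inv_val := by decide

/-- A cyclic permutation matrix and one transvection are words in the two generators. Conjugation
gives the transvections between cyclically adjacent indices, and commutators give the others. -/
theorem closure_genA_genB : Subgroup.closure {genA, genB} = ⊤ := by
  set K := Subgroup.closure {genA, genB} with hK
  let S : Matrix (Fin 4) (Fin 4) (ZMod 2) → Prop := fun M => ∃ g ∈ K, g.val = M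
  have hS {M N L : Matrix (Fin 4) (Fin 4) (ZMod 2)} (hM : S M) (hN : S N) (h : M * N = L) :
      S L := by
    obtain ⟨g, hg, rfl⟩ := hM
    obtain ⟨k, hk, rfl⟩ := hN
    exact ⟨g * k, K.mul_mem hg hk, h⟩
  -- `h` followed by a word in `A` and `B` evaluates that product of the generators
  have hA : S !![0, 0, 0, 1; 0, 0, 1, 0; 0, 1, 0, 1; 1, 0, 1, 0] :=
    ⟨genA, Subgroup.subset_closure (Or.inl rfl), rfl⟩
  have hB : S !![0, 0, 0, 1; 1, 0, 0, 1; 0, 1, 1, 0; 1, 1, 0, 1] :=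
    ⟨genB, Subgroup.subset_closure (Or.inr rfl), rfl⟩
  have hAA : S !![1, 0, 1, 0; 0, 1, 0, 1; 1, 0, 0, 0; 0, 1, 0, 0] := hS hA hA (by decide)
  have hAB : S !![1, 1, 0, 1; 0, 1, 1, 0; 0, 1, 0, 0; 0, 1, 1, 1] := hS hA hB (by decide)
  have hBA : S !![1, 0, 1, 0; 1, 0, 1, 1; 0, 1, 1, 1; 1, 0, 0, 1] := hS hB hA (by decide)
  have hBB : S !![1, 1, 0, 1; 1, 1, 0, 0; 1, 1, 1, 1; 0, 1, 0, 1] := hS hB hB (by decide)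
  have hBAAB : S !![1, 0, 0, 1; 1, 1, 1, 0; 0, 1, 0, 1; 1, 0, 1, 0] := hS hBA hAB (by decide)
  have hABAA : S !![1, 0, 1, 1; 1, 1, 0, 1; 0, 1, 0, 1; 1, 0, 0, 1] := hS hAB hAA (by decide)
  have hABAAAA : S !![0, 1, 1, 0; 1, 0, 1, 1; 0, 0, 0, 1; 1, 1, 1, 0] := hS hABAA hAA (by decide)
  have hABAAAAB : S !![1, 1, 1, 1; 1, 0, 1, 0; 1, 1, 0, 1; 1, 1, 1, 0] := hS hABAAAA hB (by decide)
  have hBAB : S !![0, 1, 1, 1; 1, 0, 1, 0; 0, 0, 1, 0; 1, 1, 0, 0] := hS hBA hB (by decide)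
  have hBABBB : S !![0, 1, 1, 0; 0, 0, 1, 0; 1, 1, 1, 1; 0, 0, 0, 1] := hS hBAB hBB (by decide)
  have hBABBBAA : S !![1, 1, 0, 1; 1, 0, 0, 0; 0, 0, 1, 1; 0, 1, 0, 0] := hS hBABBB hAA (by decide)
  have hBABBBAABB : S !![0, 1, 0, 0; 1, 1, 0, 1; 1, 0, 1, 0; 1, 1, 0, 0] :=
    hS hBABBBAA hBB (by decide)
  -- the cyclic permutation matrix
  have hP : S !![0, 0, 0, 1; 1, 0, 0, 0; 0, 1, 0, 0; 0, 0, 1, 0] := hS hBAAB hABAAAAB (by decide)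
  have hPP : S !![0, 0, 1, 0; 0, 0, 0, 1; 1, 0, 0, 0; 0, 1, 0, 0] := hS hP hP (by decide)
  have hPPP : S !![0, 1, 0, 0; 0, 0, 1, 0; 0, 0, 0, 1; 1, 0, 0, 0] := hS hPP hP (by decide)
  have h0 : S (Matrix.transvection 0 1 1) := hS hBABBBAABB hBB (by decide)
  have hcycle (i : Fin 4) (h : S (Matrix.transvection i (i + 1) 1)) :
      S (Matrix.transvection (i + 1) (i + 1 + 1) 1) :=
    hS (hS hP h rfl) hPPP (by clear h; revert i; decide)
  have h1 : ∀ i : Fin 4, S (Matrix.transvection i (i + 1) 1) := by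
    have a1 := hcycle 0 h0
    have a2 := hcycle 1 a1
    have a3 := hcycle 2 a2
    intro i
    fin_cases i
    exacts [h0, a1, a2, a3]
  have hcomm {i j k : Fin 4} (hij : i ≠ j) (hik : i ≠ k) (hkj : k ≠ j)
      (h : S (Matrix.transvection i k 1)) (h' : S (Matrix.transvection k j 1)) :
      S (Matrix.transvection i j 1) :=
    hS (hS h h' rfl) (hS h h' rfl) (transvection_eq_commutator hij hik hkj).symm
  have h2 (i : Fin 4) : S (Matrix.transvection i (i + 2) 1) :=
    hcomm (by revert i; decide) (by revert i; decide) (by revert i; decide) (h1 i)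
      (by simpa [add_assoc] using h1 (i + 1))
  have h3 (i : Fin 4) : S (Matrix.transvection i (i + 3) 1) :=
    hcomm (by revert i; decide) (by revert i; decide) (by revert i; decide) (h2 i)
      (by simpa [add_assoc] using h1 (i + 2))
  rw [eq_top_iff]
  intro g _
  have hg : S g.val := by
    refine transvection_induction S ⟨1, K.one_mem, rfl⟩ ?_ (fun M N hM hN => hS hM hN rfl) _
      ((Matrix.isUnit_iff_isUnit_det _).1 g.isUnit).ne_zero
    intro i j hij
    have : j = i + 1 ∨ j = i + 2 ∨ j = i + 3 := by
      revert i j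
      decide
    rcases this with rfl | rfl | rfl
    exacts [h1 i, h2 i, h3 i]
  obtain ⟨k, hk, hkg⟩ := hg
  rwa [← Units.ext hkg]

theorem card_GL_four : Nat.card (GL (Fin 4) (ZMod 2)) = 20160 := by
  rw [Matrix.card_GL_field]
  simp [Fin.prod_univ_succ]

/-! ### The isomorphism between `GL(4,2)` and the alternating group of degree 8 -/

/-- The alternating 4 × 4 matrix with the given entries above the diagonal, listed row by row. -/
def altMatrix (x : Fin 6 → ZMod 2) : Matrix (Fin 4) (Fin 4) (ZMod 2) :=
  !![0, x 0, x 1, x 2; x 0, 0, x 3, x 4; x 1, x 3, 0, x 5; x 2, x 4, x 5, 0]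

/-- A Kerdock set: eight alternating matrices with invertible differences. -/
def kerdock (a : Fin 8) : Matrix (Fin 4) (Fin 4) (ZMod 2) :=
  altMatrix (![![0, 0, 0, 0, 0, 0], ![0, 0, 1, 1, 0, 0], ![0, 1, 0, 1, 1, 0],
    ![0, 1, 1, 0, 1, 1], ![1, 0, 0, 1, 1, 1], ![1, 0, 1, 0, 0, 1], ![1, 1, 0, 1, 0, 1],
    ![1, 1, 1, 0, 1, 0]] a)

/-- The 28 invertible alternating matrices are the differences of pairs of elements of the Kerdock
set, and the congruence `M ↦ g M gᵀ` permutes them as a permutation of the eight letters permutes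
the pairs. This is the graph of that action, as a subgroup of the product. -/
def kerdockGraph : Subgroup (GL (Fin 4) (ZMod 2) × Equiv.Perm (Fin 8)) where
  carrier := {p | ∀ a b, p.1.val * (kerdock a + kerdock b) * p.1.valᵀ =
    kerdock (p.2 a) + kerdock (p.2 b)}
  mul_mem' := by
    intro p q hp hq a b
    change p.1.val * q.1.val * _ * (p.1.val * q.1.val)ᵀ =
      kerdock (p.2 (q.2 a)) + kerdock (p.2 (q.2 b))
    rw [← hp, ← hq, Matrix.transpose_mul]
    simp only [Matrix.mul_assoc]
  one_mem' := by
    intro a b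
    simp
  inv_mem' := by
    intro p hp a b
    have h := hp (p.2⁻¹ a) (p.2⁻¹ b)
    rw [show p.2 (p.2⁻¹ a) = a from p.2.apply_symm_apply a,
      show p.2 (p.2⁻¹ b) = b from p.2.apply_symm_apply b] at h
    change p.1⁻¹.val * _ * p.1⁻¹.valᵀ = kerdock (p.2⁻¹ a) + kerdock (p.2⁻¹ b)
    rw [← h]
    have h1 : p.1⁻¹.val * p.1.val = 1 := p.1.inv_mul
    have h2 : p.1.valᵀ * p.1⁻¹.valᵀ = 1 := by
      rw [← Matrix.transpose_mul, h1, Matrix.transpose_one]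
    rw [Matrix.mul_assoc, Matrix.mul_assoc, h2, Matrix.mul_one, ← Matrix.mul_assoc, h1,
      Matrix.one_mul]

theorem mem_kerdockGraph_of_forall {g : GL (Fin 4) (ZMod 2)} {σ : Equiv.Perm (Fin 8)}
    (h : ∀ a, g.val * kerdock a * g.valᵀ = kerdock (σ a) + kerdock (σ 0)) :
    (g, σ) ∈ kerdockGraph := by
  intro a b
  change g.val * (kerdock a + kerdock b) * g.valᵀ = _
  rw [Matrix.mul_add, Matrix.add_mul, h, h, add_add_add_comm,
    add_self_eq_zero_of_zmod2 (kerdock (σ 0)), add_zero]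

/-- The permutation of the Kerdock set induced by `genA`. -/
def kerdockPermA : Equiv.Perm (Fin 8) where
  toFun := ![1, 0, 3, 7, 6, 5, 4, 2]
  invFun := ![1, 0, 7, 2, 6, 5, 4, 3]
  left_inv := by decide
  right_inv := by decide

/-- The permutation of the Kerdock set induced by `genB`. -/
def kerdockPermB : Equiv.Perm (Fin 8) where
  toFun := ![0, 5, 3, 4, 1, 7, 2, 6]
  invFun := ![0, 4, 6, 2, 3, 1, 7, 5]
  left_inv := by decide
  right_inv := by decide

theorem kerdockGraph_fst_surjective (g : GL (Fin 4) (ZMod 2)) :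
    ∃ σ, (g, σ) ∈ kerdockGraph := by
  have htop : kerdockGraph.map (MonoidHom.fst _ _) = ⊤ := by
    rw [eq_top_iff, ← closure_genA_genB, Subgroup.closure_le]
    rintro _ (rfl | rfl)
    · exact ⟨(genA, kerdockPermA), mem_kerdockGraph_of_forall (by decide), rfl⟩
    · exact ⟨(genB, kerdockPermB), mem_kerdockGraph_of_forall (by decide), rfl⟩
  obtain ⟨⟨k, σ⟩, h, hk⟩ : g ∈ kerdockGraph.map (MonoidHom.fst _ _) := htop ▸ Subgroup.mem_top g
  obtain rfl : k = g := hk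
  exact ⟨σ, h⟩

theorem kerdock_eq_add : ∀ a b c, kerdock a = kerdock b + kerdock c → a = b ∨ b = c ∨ a = c := by
  decide

theorem kerdock_injective : Function.Injective kerdock := by
  decide

theorem kerdock_zero : kerdock 0 = 0 := by
  decide

theorem eq_one_of_mem_kerdockGraph_one_left {σ : Equiv.Perm (Fin 8)}
    (h : (1, σ) ∈ kerdockGraph) : σ = 1 := by
  have h1 (a) : kerdock a = kerdock (σ a) + kerdock (σ 0) := by
    have := h a 0
    simpa [kerdock_zero] using this
  have hfix (a : Fin 8) (ha : a ≠ 0) (ha' : a ≠ σ 0) : σ a = a := by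
    rcases kerdock_eq_add _ _ _ (h1 a) with h2 | h2 | h2
    · exact h2.symm
    · exact absurd (σ.injective h2) ha
    · exact absurd h2 ha'
  have h0 : σ 0 = 0 := by
    obtain ⟨a, ha, ha'⟩ : ∃ a : Fin 8, a ≠ 0 ∧ a ≠ σ 0 := by
      generalize σ 0 = c
      revert c
      decide
    have h2 := h1 a
    rw [hfix a ha ha', left_eq_add, ← kerdock_zero] at h2
    exact kerdock_injective h2
  ext1 a
  by_cases ha : a = 0
  · rw [ha, h0]
    rfl
  · exact hfix a ha (by rwa [h0])

/-- The Kerdock set spans the alternating matrices. -/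
theorem single_add_single_eq_sum : ∀ i j : Fin 4, i ≠ j → ∃ p : Fin 6,
    (Matrix.single i j 1 + Matrix.single j i 1 : Matrix (Fin 4) (Fin 4) (ZMod 2)) =
    ∑ a, (![![0, 0, 0, 1, 1, 1, 1, 0], ![0, 0, 1, 1, 1, 0, 0, 1], ![0, 0, 0, 1, 0, 1, 0, 1],
      ![0, 0, 1, 0, 1, 0, 1, 0], ![0, 0, 1, 1, 0, 0, 1, 1],
      ![0, 0, 0, 0, 1, 1, 1, 1]] : Fin 6 → Fin 8 → ZMod 2) p a • kerdock a := by
  decide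

/-- A matrix that fixes all alternating matrices fixes all planes spanned by two standard basis
vectors, hence all standard basis vectors. -/
theorem eq_one_of_mem_kerdockGraph_one_right {g : GL (Fin 4) (ZMod 2)}
    (h : (g, 1) ∈ kerdockGraph) : g = 1 := by
  have h1 (a) : g.val * kerdock a * g.valᵀ = kerdock a := by
    have := h a 0
    simpa [kerdock_zero] using this
  have h2 (i j : Fin 4) (hij : i ≠ j) :
      g.val * (Matrix.single i j 1 + Matrix.single j i 1) * g.valᵀ =
        Matrix.single i j 1 + Matrix.single j i 1 := by
    obtain ⟨p, hp⟩ := single_add_single_eq_sum i j hij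
    rw [hp, Finset.mul_sum, Finset.sum_mul]
    refine Finset.sum_congr rfl fun a _ => ?_
    rw [Matrix.mul_smul, Matrix.smul_mul, h1]
  have h3 (i j : Fin 4) (hij : i ≠ j) (k l : Fin 4) :
      g.val k i * g.val l j + g.val k j * g.val l i =
        (if i = k ∧ j = l then 1 else 0) + (if j = k ∧ i = l then 1 else 0) := by
    have := congrFun (congrFun (h2 i j hij) k) l
    rw [Matrix.mul_add, Matrix.add_mul, Matrix.add_apply, Matrix.add_apply] at this
    simpa [Matrix.mul_apply, Matrix.single_apply, ite_and, Finset.sum_ite_eq,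
      Matrix.transpose_apply] using this
  have hoff (i k : Fin 4) (hik : i ≠ k) : g.val k i = 0 := by
    obtain ⟨j, hij, hjk⟩ : ∃ j : Fin 4, i ≠ j ∧ j ≠ k := by
      revert i k
      decide
    have e1 := h3 i j hij i j
    have e2 := h3 i j hij k i
    have e3 := h3 i j hij k j
    simp only [hij, hij.symm, hik, hjk, and_self, false_and, if_true, if_false,
      add_zero] at e1 e2 e3
    have hx := add_self_eq_zero_of_zmod2 (g.val i i * g.val j i * g.val k j)
    linear_combination (-g.val k i) * e1 + g.val j i * e2 + g.val i i * e3 - hx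
  apply Units.ext
  ext i j
  by_cases hij : i = j
  · subst hij
    obtain ⟨j, hij⟩ : ∃ j : Fin 4, i ≠ j := (exists_ne i).imp fun _ h => h.symm
    have e := h3 i j hij i j
    rw [hoff j i hij.symm, zero_mul] at e
    rw [Units.val_one, Matrix.one_apply_eq]
    refine zmod2_eq_one fun h0 => ?_
    simp [h0, hij.symm] at e
  · rw [hoff j i (Ne.symm hij), Units.val_one, Matrix.one_apply_ne hij]

/-- The exceptional isomorphism `GL(4,2) ≅ A₈`. -/
theorem nonempty_GL_four_mulEquiv :
    Nonempty (GL (Fin 4) (ZMod 2) ≃* alternatingGroup (Fin 8)) := by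
  let f : kerdockGraph →* GL (Fin 4) (ZMod 2) := (MonoidHom.fst _ _).comp kerdockGraph.subtype
  let s : kerdockGraph →* Equiv.Perm (Fin 8) := (MonoidHom.snd _ _).comp kerdockGraph.subtype
  have hf : Function.Bijective f := by
    refine ⟨(injective_iff_map_eq_one f).2 ?_, fun g => ?_⟩
    · rintro ⟨⟨g, σ⟩, h⟩ hg
      obtain rfl : g = 1 := hg
      exact Subtype.ext (Prod.ext rfl (eq_one_of_mem_kerdockGraph_one_left h))
    · obtain ⟨σ, h⟩ := kerdockGraph_fst_surjective g
      exact ⟨⟨(g, σ), h⟩, rfl⟩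
  have hs : Function.Injective s := by
    refine (injective_iff_map_eq_one s).2 ?_
    rintro ⟨⟨g, σ⟩, h⟩ hg
    obtain rfl : σ = 1 := hg
    exact Subtype.ext (Prod.ext (eq_one_of_mem_kerdockGraph_one_right h) rfl)
  let F := (MulEquiv.ofBijective f hf).symm.trans (MonoidHom.ofInjective hs)
  have hcard : Nat.card s.range = 20160 := by
    rw [← Nat.card_congr F.toEquiv, card_GL_four]
  have hindex : s.range.index = 2 := by
    have h := s.range.card_mul_index
    rw [hcard, Nat.card_perm, Nat.card_fin, show Nat.factorial 8 = 20160 * 2 from rfl] at h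
    exact Nat.eq_of_mul_eq_mul_left (by norm_num) h
  exact ⟨F.trans (MulEquiv.subgroupCongr (Equiv.Perm.eq_alternatingGroup_of_index_eq_two hindex))⟩

/-! ### Words as functions on the points -/

/-- The points of the affine space `𝔽₂⁴`. The nonzero points label the coordinates of a word. -/
abbrev Point : Type := Fin 4 → ZMod 2

/-- The standard basis vectors. -/
def unitPt (i : Fin 4) : Point := Pi.single i 1

theorem unitPt_ne_zero (i : Fin 4) : unitPt i ≠ 0 := by
  simp [unitPt]

section Codes

variable (e : Fin 15 ≃ {v : Fin 4 → ZMod 2 // v ≠ 0})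

/-- The word whose coordinates are the values of a function at the nonzero points. -/
def evalWord : (Point → ZMod 2) →ₗ[ZMod 2] Word 15 where
  toFun f k := f (e k).1
  map_add' _ _ := rfl
  map_smul' _ _ := rfl

theorem evalWord_apply (f : Point → ZMod 2) (k : Fin 15) : evalWord e f k = f (e k).1 := rfl

theorem evalWord_eq_iff {f g : Point → ZMod 2} :
    evalWord e f = evalWord e g ↔ ∀ v, v ≠ 0 → f v = g v := by
  constructor
  · intro h v hv
    have := congrFun h (e.symm ⟨v, hv⟩)
    rwa [evalWord_apply, evalWord_apply, e.apply_symm_apply] at this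
  · intro h
    ext k
    exact h _ (e k).2

theorem sum_evalWord {M : Type*} [AddCommMonoid M] (f : Point → M) (h0 : f 0 = 0) :
    ∑ k, f (e k).1 = ∑ v, f v := by
  rw [e.sum_comp fun v : {v : Point // v ≠ 0} => f v.1,
    ← Finset.sum_subtype (Finset.univ.filter (· ≠ 0)) (by simp) f]
  exact Finset.sum_filter_of_ne fun v _ hv h => hv (h ▸ h0)

theorem hammingNorm_evalWord (f : Point → ZMod 2) (h0 : f 0 = 0) :
    hammingNorm (evalWord e f) = (Finset.univ.filter fun v => f v ≠ 0).card := by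
  unfold hammingNorm
  simp only [Finset.card_filter]
  exact sum_evalWord e (fun v => if f v ≠ 0 then 1 else 0) (by simp [h0])

theorem columns_mulVec_single (k : Fin 15) :
    columns e *ᵥ Pi.single k 1 = (e k).1 := by
  rw [Matrix.mulVec_single_one]
  rfl

theorem mem_hamming_iff {x : Word 15} :
    x ∈ hamming e ↔ ∀ i, ∑ k, (e k).1 i * x k = 0 :=
  funext_iff

theorem mem_simplex_iff {x : Word 15} :
    x ∈ simplex e ↔ ∃ a : Point, x = evalWord e fun v => a ⬝ᵥ v := by
  unfold simplex
  rw [Submodule.mem_span_range_iff_exists_fun]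
  have h (a : Point) : ∑ i, a i • (columns e).row i = evalWord e fun v => a ⬝ᵥ v := by
    ext k
    rw [Finset.sum_apply]
    rfl
  simp only [h, eq_comm]

theorem linear_mem_simplex (a : Point) : evalWord e (fun v => a ⬝ᵥ v) ∈ simplex e :=
  (mem_simplex_iff e).2 ⟨a, rfl⟩

theorem evalWord_mem_hamming {f : Point → ZMod 2} (h : ∀ i, ∑ v, v i * f v = 0) :
    evalWord e f ∈ hamming e := by
  rw [mem_hamming_iff]
  intro i
  exact (sum_evalWord e (fun v => v i * f v) (by simp)).trans (h i)

theorem mem_evenSubcode_iff {D : Submodule (ZMod 2) (Word 15)} {x : Word 15} :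
    x ∈ evenSubcode D ↔ x ∈ D ∧ ∑ k, x k = 0 := by
  unfold evenSubcode
  rw [Submodule.mem_inf, LinearMap.mem_ker, LinearMap.sum_apply]
  rfl

theorem evalWord_mem_even {f : Point → ZMod 2} (h0 : f 0 = 0) (h : ∀ i, ∑ v, v i * f v = 0)
    (h1 : ∑ v, f v = 0) : evalWord e f ∈ evenSubcode (hamming e) :=
  mem_evenSubcode_iff.2 ⟨evalWord_mem_hamming e h, (sum_evalWord e f h0).trans h1⟩

/-! ### Dimensions, weights and duals -/

theorem dualCode_simplex : dualCode (simplex e) = hamming e := by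
  ext x
  rw [mem_hamming_iff]
  constructor
  · intro h i
    have := h _ (linear_mem_simplex e (unitPt i))
    simpa [dotProduct, evalWord_apply, unitPt, Pi.single_apply] using this
  · intro h c hc
    obtain ⟨a, rfl⟩ := (mem_simplex_iff e).1 hc
    have hk : evalWord e (fun v => a ⬝ᵥ v) ⬝ᵥ x = ∑ i, a i * ∑ k, (e k).1 i * x k := by
      simp only [dotProduct, evalWord_apply, Finset.sum_mul, Finset.mul_sum]
      rw [Finset.sum_comm]
      simp only [mul_assoc]
    rw [hk]
    exact Finset.sum_eq_zero fun i _ => by rw [h i, mul_zero]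

/-- A word orthogonal to the words of weight at most 5 that express a point by the basis vectors is
a linear function of the point. -/
theorem dualCode_hamming : dualCode (hamming e) = simplex e := by
  apply le_antisymm
  · intro x hx
    let p (i : Fin 4) : Fin 15 := e.symm ⟨unitPt i, unitPt_ne_zero i⟩
    have hp (i : Fin 4) : (e (p i)).1 = unitPt i := by
      rw [e.apply_symm_apply]
    rw [mem_simplex_iff]
    refine ⟨fun i => x (p i), funext fun k => ?_⟩
    have hmem : Pi.single k 1 + ∑ i, (e k).1 i • Pi.single (p i) 1 ∈ hamming e := by
      change columns e *ᵥ _ = 0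
      rw [Matrix.mulVec_add, Matrix.mulVec_sum, columns_mulVec_single]
      simp only [Matrix.mulVec_smul, columns_mulVec_single, hp]
      have : ∑ i, (e k).1 i • unitPt i = (e k).1 := by
        ext j
        simp [Finset.sum_apply, unitPt, Pi.single_apply]
      rw [this, add_self_eq_zero_of_zmod2]
    have h := hx _ hmem
    rw [add_dotProduct, sum_dotProduct] at h
    simp only [smul_dotProduct, single_dotProduct, one_mul, smul_eq_mul] at h
    rw [evalWord_apply, dotProduct, eq_neg_of_add_eq_zero_left h, ZMod.neg_eq_self_mod_two]
    exact Finset.sum_congr rfl fun i _ => mul_comm _ _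
  · intro x hx y hy
    rw [← dualCode_simplex] at hy
    rw [dotProduct_comm]
    exact hy x hx

theorem simplex_le_even : simplex e ≤ evenSubcode (hamming e) := by
  intro x hx
  obtain ⟨a, rfl⟩ := (mem_simplex_iff e).1 hx
  refine evalWord_mem_even e (dotProduct_zero a) ?_ ?_
  · clear hx
    revert a
    decide
  · clear hx
    revert a
    decide

theorem even_le_hamming : evenSubcode (hamming e) ≤ hamming e := inf_le_left

theorem simplex_le_hamming : simplex e ≤ hamming e :=
  (simplex_le_even e).trans (even_le_hamming e)

theorem linearIndependent_row : LinearIndependent (ZMod 2) (columns e).row := by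
  rw [Fintype.linearIndependent_iff]
  intro g hg i
  have := congrFun hg (e.symm ⟨unitPt i, unitPt_ne_zero i⟩)
  simpa [columns, Finset.sum_apply, unitPt, Pi.single_apply, Matrix.row] using this

theorem finrank_simplex : Module.finrank (ZMod 2) (simplex e) = 4 :=
  finrank_span_eq_card (linearIndependent_row e)

theorem finrank_hamming : Module.finrank (ZMod 2) (hamming e) = 11 := by
  have h := LinearMap.finrank_range_add_finrank_ker (columns e).mulVecLin
  have hr : Module.finrank (ZMod 2) (LinearMap.range (columns e).mulVecLin) = 4 := by
    change (columns e).rank = 4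
    rw [Matrix.rank_eq_finrank_span_row]
    exact finrank_simplex e
  rw [hr, Module.finrank_fin_fun] at h
  change 4 + Module.finrank (ZMod 2) (hamming e) = 15 at h
  omega

theorem hammingNorm_of_mem_simplex {c : Word 15} (hc : c ∈ simplex e) (h0 : c ≠ 0) :
    hammingNorm c = 8 := by
  obtain ⟨a, rfl⟩ := (mem_simplex_iff e).1 hc
  have ha : a ≠ 0 := by
    rintro rfl
    apply h0
    ext k
    exact zero_dotProduct (e k).1
  rw [hammingNorm_evalWord e _ (dotProduct_zero a)]
  clear hc h0
  revert a
  decide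

theorem isLinearCode_simplex : IsLinearCode (simplex e) 4 8 := by
  have h : evalWord e (fun v => unitPt 0 ⬝ᵥ v) ≠ 0 := by
    intro h
    have := (evalWord_eq_iff e (g := 0)).1 h (unitPt 0) (unitPt_ne_zero 0)
    revert this
    decide
  refine ⟨finrank_simplex e, ⟨_, linear_mem_simplex e (unitPt 0), h,
    hammingNorm_of_mem_simplex e (linear_mem_simplex e _) h⟩, ?_⟩
  rintro w ⟨c, hc, h0, rfl⟩
  exact (hammingNorm_of_mem_simplex e hc h0).ge

/-- The columns of the parity check matrix are nonzero and distinct. -/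
theorem three_le_hammingNorm {c : Word 15} (hc : c ∈ hamming e) (h0 : c ≠ 0) :
    3 ≤ hammingNorm c := by
  by_contra! hlt
  set s := Finset.univ.filter fun k => c k ≠ 0 with hs
  have hsum : ∑ k ∈ s, (e k).1 = 0 := by
    ext i
    have h := (mem_hamming_iff e).1 hc i
    rw [Finset.sum_apply, Pi.zero_apply, ← h, hs, Finset.sum_filter]
    refine Finset.sum_congr rfl fun k _ => ?_
    rcases zmod2_cases (c k) with h | h <;> simp [h]
  have hpos : 0 < s.card := hammingNorm_pos_iff.2 h0
  have hcases : s.card = 1 ∨ s.card = 2 := by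
    change s.card < 3 at hlt
    omega
  rcases hcases with h | h
  · obtain ⟨k, hk⟩ := Finset.card_eq_one.1 h
    rw [hk, Finset.sum_singleton] at hsum
    exact (e k).2 hsum
  · obtain ⟨k, l, hkl, hk⟩ := Finset.card_eq_two.1 h
    rw [hk, Finset.sum_pair hkl] at hsum
    have : (e k).1 = (e l).1 := by
      simpa [add_assoc, add_self_eq_zero_of_zmod2] using congrArg (· + (e l).1) hsum
    exact hkl (e.injective (Subtype.ext this))

/-- The characteristic function of a line through the origin, with the origin removed. -/
def lineFun (v : Point) : ZMod 2 :=
  if v = unitPt 0 ∨ v = unitPt 1 ∨ v = unitPt 0 + unitPt 1 then 1 else 0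

theorem line_mem_hamming : evalWord e lineFun ∈ hamming e :=
  evalWord_mem_hamming e (by decide)

theorem hammingNorm_line : hammingNorm (evalWord e lineFun) = 3 := by
  rw [hammingNorm_evalWord e _ (by decide)]
  decide

theorem isLinearCode_hamming : IsLinearCode (hamming e) 11 3 := by
  refine ⟨finrank_hamming e, ⟨_, line_mem_hamming e, ?_, hammingNorm_line e⟩, ?_⟩
  · rw [← hammingNorm_ne_zero_iff, hammingNorm_line]
    norm_num
  · rintro w ⟨c, hc, h0, rfl⟩
    exact three_le_hammingNorm e hc h0

theorem one_mem_hamming : (1 : Word 15) ∈ hamming e :=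
  evalWord_mem_hamming e (f := 1) (by decide)

theorem sum_one_word : ∑ k, (1 : Word 15) k = 1 := by
  decide

theorem one_notMem_even : (1 : Word 15) ∉ evenSubcode (hamming e) := by
  intro h
  have := (mem_evenSubcode_iff.1 h).2
  rw [sum_one_word] at this
  exact one_ne_zero this

theorem even_inf_span_one : evenSubcode (hamming e) ⊓ Submodule.span (ZMod 2) {1} = ⊥ := by
  rw [eq_bot_iff]
  rintro x ⟨hx, hx'⟩
  obtain ⟨t, rfl⟩ := Submodule.mem_span_singleton.1 hx'
  rcases zmod2_cases t with rfl | rfl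
  · exact zero_smul _ _
  · exact absurd (by simpa using hx) (one_notMem_even e)

theorem exists_even_add_smul_one {x : Word 15} (hx : x ∈ hamming e) :
    ∃ t : ZMod 2, x - t • 1 ∈ evenSubcode (hamming e) := by
  refine ⟨∑ k, x k, mem_evenSubcode_iff.2
    ⟨sub_mem hx (Submodule.smul_mem _ _ (one_mem_hamming e)), ?_⟩⟩
  have : ∑ k, ((∑ k, x k) • (1 : Word 15)) k = (∑ k, x k) * ∑ k, (1 : Word 15) k := by
    rw [Finset.mul_sum]
    rfl
  simp only [Pi.sub_apply, Finset.sum_sub_distrib]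
  rw [this, sum_one_word, mul_one, sub_self]

theorem even_sup_span_one :
    evenSubcode (hamming e) ⊔ Submodule.span (ZMod 2) {1} = hamming e := by
  apply le_antisymm
  · rw [sup_le_iff, Submodule.span_singleton_le_iff_mem]
    exact ⟨even_le_hamming e, one_mem_hamming e⟩
  · intro x hx
    obtain ⟨t, ht⟩ := exists_even_add_smul_one e hx
    exact Submodule.mem_sup.2 ⟨_, ht, _,
      Submodule.smul_mem _ t (Submodule.mem_span_singleton_self _), sub_add_cancel _ _⟩

theorem finrank_even : Module.finrank (ZMod 2) (evenSubcode (hamming e)) = 10 := by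
  have h := Submodule.finrank_sup_add_finrank_inf_eq (evenSubcode (hamming e))
    (Submodule.span (ZMod 2) {(1 : Word 15)})
  rw [even_sup_span_one, even_inf_span_one, finrank_hamming, finrank_bot,
    finrank_span_singleton one_ne_zero] at h
  omega

theorem finrank_logical {C₁ C₂ : Submodule (ZMod 2) (Word 15)} (h : C₂ ≤ C₁) :
    Module.finrank (ZMod 2) (Logical C₁ C₂) + Module.finrank (ZMod 2) C₂ =
      Module.finrank (ZMod 2) C₁ := by
  rw [← (Submodule.submoduleOfEquivOfLe h).finrank_eq]
  exact Submodule.finrank_quotient_add_finrank _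

theorem finrank_logical_hamming :
    Module.finrank (ZMod 2) (Logical (hamming e) (simplex e)) = 7 := by
  have h := finrank_logical (simplex_le_hamming e)
  rw [finrank_simplex, finrank_hamming] at h
  omega

theorem finrank_logical_even :
    Module.finrank (ZMod 2) (Logical (evenSubcode (hamming e)) (simplex e)) = 6 := by
  have h := finrank_logical (simplex_le_even e)
  rw [finrank_simplex, finrank_even] at h
  omega

/-- The product of the coordinates number 0 and 1 is an even word of the Hamming code that meets
the line in one point. -/
theorem line_notMem_dualCode {D : Submodule (ZMod 2) (Word 15)}
    (h : evenSubcode (hamming e) ≤ D) : evalWord e lineFun ∉ dualCode D := by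
  intro hl
  have h1 := hl _ (h (evalWord_mem_even e (f := fun v => v 0 * v 1) (by decide) (by decide)
    (by decide)))
  have h2 := (sum_evalWord e (fun v => v 0 * v 1 * lineFun v) (by decide)).symm.trans h1
  revert h2
  decide

theorem isQuantumCode_of_even_le {D : Submodule (ZMod 2) (Word 15)} {k : ℕ}
    (h : evenSubcode (hamming e) ≤ D) (h' : D ≤ hamming e)
    (hk : Module.finrank (ZMod 2) (Logical D (simplex e)) = k) :
    IsQuantumCode (codeSpace D (simplex e)) k 3 := by
  refine isQuantumCode ((simplex_le_even e).trans h) hk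
    (fun c hc => three_le_hammingNorm e (h' hc)) ?_ ?_
  · rw [dualCode_simplex]
    exact fun c => three_le_hammingNorm e
  · rw [dualCode_simplex]
    exact ⟨_, line_mem_hamming e, line_notMem_dualCode e h, hammingNorm_line e⟩

/-! ### Automorphisms -/

theorem permAut_le_permAut_dualCode {n : ℕ} (C : Submodule (ZMod 2) (Word n)) :
    permAut C ≤ permAut (dualCode C) := by
  intro π hπ x hx c hc
  have h := hx _ ((permAut C).inv_mem hπ c hc)
  rw [← h]
  refine Fintype.sum_equiv π _ _ fun i => ?_
  rw [permWord_apply, permWord_apply]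
  change _ = c (π.symm (π i)) * _
  rw [π.symm_apply_apply]

theorem permAut_simplex_le_hamming : permAut (simplex e) ≤ permAut (hamming e) := by
  rw [← dualCode_simplex]
  exact permAut_le_permAut_dualCode _

theorem permAut_simplex_le_even : permAut (simplex e) ≤ permAut (evenSubcode (hamming e)) := by
  intro π hπ x hx
  obtain ⟨h1, h2⟩ := mem_evenSubcode_iff.1 hx
  refine mem_evenSubcode_iff.2 ⟨permAut_simplex_le_hamming e hπ x h1, ?_⟩
  rw [← h2]
  exact Equiv.sum_comp π x

theorem jointAut_hamming : jointAut (hamming e) (simplex e) = permAut (simplex e) :=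
  inf_eq_right.2 (permAut_simplex_le_hamming e)

theorem jointAut_even : jointAut (evenSubcode (hamming e)) (simplex e) = permAut (simplex e) :=
  inf_eq_right.2 (permAut_simplex_le_even e)

theorem GL_mulVec_ne_zero (A : GL (Fin 4) (ZMod 2)) {v : Point} (hv : v ≠ 0) :
    A.val *ᵥ v ≠ 0 := by
  intro h
  apply hv
  have := congrArg (A⁻¹.val *ᵥ ·) h
  simpa [Matrix.mulVec_mulVec] using this

/-- The permutation of the coordinates induced by an element of `GL(4,2)`. -/
def permHom : GL (Fin 4) (ZMod 2) →* Equiv.Perm (Fin 15) :=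
  MonoidHom.toHomPerm
    { toFun := fun A k => e.symm ⟨A.val *ᵥ (e k).1, GL_mulVec_ne_zero A (e k).2⟩
      map_one' := by
        funext k
        change e.symm ⟨(1 : Matrix _ _ _) *ᵥ (e k).1, _⟩ = k
        rw [e.symm_apply_eq]
        apply Subtype.ext
        exact Matrix.one_mulVec (e k).1
      map_mul' := by
        intro A B
        funext k
        change _ = e.symm ⟨A.val *ᵥ (e (e.symm _)).1, _⟩
        congr 2
        rw [e.apply_symm_apply, Matrix.mulVec_mulVec]
        rfl }

theorem permHom_apply (A : GL (Fin 4) (ZMod 2)) (k : Fin 15) :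
    (e (permHom e A k)).1 = A.val *ᵥ (e k).1 := by
  change (e (e.symm _)).1 = _
  rw [e.apply_symm_apply]

theorem permWord_permHom (A : GL (Fin 4) (ZMod 2)) (f : Point → ZMod 2) :
    permWord (permHom e A) (evalWord e f) = evalWord e fun v => f (A.val *ᵥ v) := by
  ext k
  rw [permWord_apply, evalWord_apply, evalWord_apply, permHom_apply]

theorem permHom_injective : Function.Injective (permHom e) := by
  intro A B h
  apply Units.ext
  refine Matrix.ext_of_mulVec_single fun i => ?_
  have h1 := permHom_apply e A (e.symm ⟨unitPt i, unitPt_ne_zero i⟩)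
  rw [h, permHom_apply, e.apply_symm_apply] at h1
  exact h1.symm

theorem range_permHom : (permHom e).range = permAut (simplex e) := by
  apply le_antisymm
  · rintro _ ⟨A, rfl⟩ c hc
    obtain ⟨a, rfl⟩ := (mem_simplex_iff e).1 hc
    rw [permWord_permHom]
    simp only [Matrix.dotProduct_mulVec]
    exact linear_mem_simplex e _
  · intro π hπ
    have h (i : Fin 4) : ∃ a : Point, ∀ k, (e (π k)).1 i = a ⬝ᵥ (e k).1 := by
      obtain ⟨a, ha⟩ := (mem_simplex_iff e).1 (hπ _ (linear_mem_simplex e (unitPt i)))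
      refine ⟨a, fun k => ?_⟩
      have := congrFun ha k
      rw [permWord_apply, evalWord_apply, evalWord_apply, unitPt, single_dotProduct,
        one_mul] at this
      exact this
    choose a ha using h
    have hM (k : Fin 15) : Matrix.of a *ᵥ (e k).1 = (e (π k)).1 := funext fun i => (ha i k).symm
    have hdet : (Matrix.of a).det ≠ 0 := by
      intro h0
      obtain ⟨v, hv, hv'⟩ := Matrix.exists_mulVec_eq_zero_iff.2 h0
      have := hM (e.symm ⟨v, hv⟩)
      rw [e.apply_symm_apply, hv'] at this
      exact (e _).2 this.symm
    refine ⟨Matrix.GeneralLinearGroup.mkOfDetNeZero (Matrix.of a) hdet, Equiv.ext fun k => ?_⟩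
    apply e.injective
    apply Subtype.ext
    rw [permHom_apply]
    exact hM k

/-- The automorphism group of the simplex code is `GL(4,2)`. -/
def GLEquivPermAut : GL (Fin 4) (ZMod 2) ≃* permAut (simplex e) :=
  (MonoidHom.ofInjective (permHom_injective e)).trans (MulEquiv.subgroupCongr (range_permHom e))

end Codes

section LogicalSpaces

variable (e : Fin 15 ≃ {v : Fin 4 → ZMod 2 // v ≠ 0})

/-! ### The action on alternating forms -/

/-- The first index of the pair of coordinates number `p`. -/
def pairFst : Fin 6 → Fin 4 := ![0, 0, 0, 1, 1, 2]

/-- The second index of the pair of coordinates number `p`. -/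
def pairSnd : Fin 6 → Fin 4 := ![1, 2, 3, 2, 3, 3]

/-- The product of the two coordinates of a pair, as a function on the points. -/
def quad (p : Fin 6) (v : Point) : ZMod 2 := v (pairFst p) * v (pairSnd p)

/-- The coefficients of the polar form of a function. They vanish on linear functions. -/
def polar (p : Fin 6) : (Point → ZMod 2) →ₗ[ZMod 2] ZMod 2 where
  toFun f := f (unitPt (pairFst p) + unitPt (pairSnd p)) + f (unitPt (pairFst p)) +
    f (unitPt (pairSnd p))
  map_add' f g := by
    simp only [Pi.add_apply]
    ring
  map_smul' c f := by
    simp only [Pi.smul_apply, smul_eq_mul, RingHom.id_apply]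
    ring

theorem polar_apply (p : Fin 6) (f : Point → ZMod 2) :
    polar p f = f (unitPt (pairFst p) + unitPt (pairSnd p)) +
      f (unitPt (pairFst p)) + f (unitPt (pairSnd p)) := rfl

theorem polar_quad : ∀ p q, polar p (quad q) = if q = p then 1 else 0 := by
  simp only [polar_apply]
  decide

theorem polar_linear (p : Fin 6) (a : Point) : polar p (fun v => a ⬝ᵥ v) = 0 := by
  rw [polar_apply, dotProduct_add, add_assoc, add_self_eq_zero_of_zmod2]

theorem polar_congr {f g : Point → ZMod 2} (h : evalWord e f = evalWord e g) (p : Fin 6) :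
    polar p f = polar p g := by
  have h0 : ∀ p, unitPt (pairFst p) + unitPt (pairSnd p) ≠ 0 := by decide
  rw [evalWord_eq_iff] at h
  rw [polar_apply, polar_apply, h _ (h0 p), h _ (unitPt_ne_zero _), h _ (unitPt_ne_zero _)]

theorem quad_mem_even (p : Fin 6) : evalWord e (quad p) ∈ evenSubcode (hamming e) :=
  evalWord_mem_even e (by revert p; decide) (by revert p; decide) (by revert p; decide)

/-- The space `H₀ / C` of quadratic polynomials without constant term modulo linear ones, that is,
of alternating forms. -/
abbrev AltSpace : Type := Logical (evenSubcode (hamming e)) (simplex e)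

/-- The word of a product of two coordinates, in the even subcode of the Hamming code. -/
def quadWord (p : Fin 6) : evenSubcode (hamming e) := ⟨evalWord e (quad p), quad_mem_even e p⟩

theorem sum_smul_coset_quadWord (g : Fin 6 → ZMod 2) :
    ∑ p, g p • coset _ (simplex e) (quadWord e p) =
      coset _ (simplex e) (∑ p, g p • quadWord e p) := by
  change _ = Submodule.mkQ _ _
  rw [map_sum]
  rfl

theorem coe_sum_smul_quadWord (g : Fin 6 → ZMod 2) :
    ((∑ p, g p • quadWord e p : evenSubcode (hamming e)) : Word 15) =
      evalWord e (∑ p, g p • quad p) := by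
  rw [AddSubmonoidClass.coe_finsetSum, map_sum]
  rfl

theorem linearIndependent_quad :
    LinearIndependent (ZMod 2) fun p => coset _ (simplex e) (quadWord e p) := by
  rw [Fintype.linearIndependent_iff]
  intro g hg p
  rw [sum_smul_coset_quadWord] at hg
  have hmem := (Submodule.Quotient.mk_eq_zero _).1 hg
  change ((∑ p, g p • quadWord e p : evenSubcode (hamming e)) : Word 15) ∈ simplex e at hmem
  rw [coe_sum_smul_quadWord, mem_simplex_iff] at hmem
  obtain ⟨a, ha⟩ := hmem
  have h := polar_congr e ha p
  rw [polar_linear, map_sum] at h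
  simpa [polar_quad] using h

/-- The basis of the products of two coordinates. -/
def quadBasis : Module.Basis (Fin 6) (ZMod 2) (AltSpace e) :=
  basisOfLinearIndependentOfCardEqFinrank (linearIndependent_quad e)
    (by rw [finrank_logical_even, Fintype.card_fin])

theorem quadBasis_apply (p : Fin 6) :
    quadBasis e p = coset _ (simplex e) (quadWord e p) := by
  simp [quadBasis]

/-- The second compound matrix of a 4 × 4 matrix: the matrix of the substitution of linear forms in
the products of two coordinates, modulo linear forms. -/
def compound (A : Matrix (Fin 4) (Fin 4) (ZMod 2)) : Matrix (Fin 6) (Fin 6) (ZMod 2) :=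
  Matrix.of fun q p => A (pairFst p) (pairFst q) * A (pairSnd p) (pairSnd q) +
    A (pairFst p) (pairSnd q) * A (pairSnd p) (pairFst q)

/-- Over `𝔽₂` the squares in a product of two linear forms are linear. -/
theorem quad_mulVec (A : Matrix (Fin 4) (Fin 4) (ZMod 2)) (p : Fin 6) (v : Point) :
    quad p (A *ᵥ v) = (∑ q, compound A q p • quad q) v +
      (fun k => A (pairFst p) k * A (pairSnd p) k) ⬝ᵥ v := by
  have hsq (c : ZMod 2) : c * c = c := by
    revert c
    decide
  have key (r s : Fin 4 → ZMod 2) : (r ⬝ᵥ v) * (s ⬝ᵥ v) =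
      ∑ q, (r (pairFst q) * s (pairSnd q) + r (pairSnd q) * s (pairFst q)) * quad q v +
        (fun k => r k * s k) ⬝ᵥ v := by
    simp only [dotProduct, Fin.sum_univ_six, Fin.sum_univ_four, quad]
    simp only [pairFst, pairSnd, Matrix.cons_val]
    linear_combination r 0 * s 0 * hsq (v 0) + r 1 * s 1 * hsq (v 1) + r 2 * s 2 * hsq (v 2) +
      r 3 * s 3 * hsq (v 3)
  rw [Finset.sum_apply]
  exact key (A (pairFst p)) (A (pairSnd p))

theorem toMatrix_logicalPerm {π : jointAut (evenSubcode (hamming e)) (simplex e)}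
    {A : GL (Fin 4) (ZMod 2)} (h : π.1 = permHom e A) :
    LinearMap.toMatrix (quadBasis e) (quadBasis e) (logicalPerm π).toLinearMap =
      compound A.val := by
  have key (p : Fin 6) : logicalPerm π (quadBasis e p) =
      ∑ q, compound A.val q p • quadBasis e q := by
    simp only [quadBasis_apply]
    rw [sum_smul_coset_quadWord, logicalPerm_coset, coset_eq_iff, coe_sum_smul_quadWord]
    change permWord π.1 (evalWord e (quad p)) - _ ∈ _
    rw [h, permWord_permHom, ← map_sub]
    have : (fun v => quad p (A.val *ᵥ v)) - ∑ q, compound A.val q p • quad q =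
        fun v => (fun k => A.val (pairFst p) k * A.val (pairSnd p) k) ⬝ᵥ v := by
      funext v
      rw [Pi.sub_apply, quad_mulVec, add_sub_cancel_left]
    rw [this]
    exact linear_mem_simplex e _
  ext q p
  rw [LinearMap.toMatrix_apply]
  change (quadBasis e).repr (logicalPerm π (quadBasis e p)) q = _
  rw [key, (quadBasis e).repr_sum_self]

/-- A cyclic ordering of the pairs in which neighbours share an index. -/
def nextPair : Fin 6 → Fin 6 := ![1, 2, 5, 0, 3, 4]

/-- The index of a pair that is replaced in the next pair. -/
def oldIndex : Fin 6 → Fin 4 := ![1, 2, 0, 2, 3, 2]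

/-- The index of the next pair that replaces the old one. -/
def newIndex : Fin 6 → Fin 4 := ![2, 3, 2, 0, 2, 1]

/-- The augmentation ideal of the group of substitutions is the full matrix algebra: if `t` and `t'`
are transvections on complementary pairs of coordinates, then `(1 + t) (1 + t')` is a matrix unit,
and multiplication by further `1 + t` on the left and on the right gives the other matrix units. -/
theorem augmentationFull_logicalPerm :
    AugmentationFull (Set.range
      (logicalPerm (C₁ := evenSubcode (hamming e)) (C₂ := simplex e))) := by
  intro I hone hl hr
  let B := quadBasis e
  let I' : Set (Matrix (Fin 6) (Fin 6) (ZMod 2)) := {M | Matrix.toLin B B M ∈ I}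
  let N (i j : Fin 4) : Matrix (Fin 6) (Fin 6) (ZMod 2) :=
    1 + compound (Matrix.transvection i j 1)
  have hT (i j : Fin 4) (hij : i ≠ j) :
      ∃ a ∈ Set.range (logicalPerm (C₁ := evenSubcode (hamming e)) (C₂ := simplex e)),
        Matrix.toLin B B (N i j) = 1 + a.toLinearMap := by
    let A : GL (Fin 4) (ZMod 2) := Matrix.GeneralLinearGroup.mkOfDetNeZero
      (Matrix.transvection i j 1) (by rw [Matrix.det_transvection_of_ne i j hij]; exact one_ne_zero)
    have hmem : permHom e A ∈ jointAut (evenSubcode (hamming e)) (simplex e) := by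
      rw [jointAut_even, ← range_permHom]
      exact ⟨A, rfl⟩
    refine ⟨_, ⟨⟨permHom e A, hmem⟩, rfl⟩, ?_⟩
    have h := toMatrix_logicalPerm e (π := ⟨permHom e A, hmem⟩) (A := A) rfl
    rw [map_add, Matrix.toLin_one]
    congr 1
    rw [show Matrix.transvection i j 1 = A.val from rfl, ← h, Matrix.toLin_toMatrix]
  have hN (i j) (hij : i ≠ j) : N i j ∈ I' := by
    obtain ⟨a, ha, h⟩ := hT i j hij
    change Matrix.toLin B B _ ∈ I
    rw [h]
    exact hone a ha
  have hNl (i j) (hij : i ≠ j) (M) (hM : M ∈ I') : N i j * M ∈ I' := by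
    obtain ⟨a, ha, h⟩ := hT i j hij
    change Matrix.toLin B B _ ∈ I
    rw [Matrix.toLin_mul B B B, h]
    change (1 + a.toLinearMap) * Matrix.toLin B B M ∈ I
    rw [add_mul, one_mul]
    exact I.add_mem hM (hl a ha _ hM)
  have hNr (i j) (hij : i ≠ j) (M) (hM : M ∈ I') : M * N i j ∈ I' := by
    obtain ⟨a, ha, h⟩ := hT i j hij
    change Matrix.toLin B B _ ∈ I
    rw [Matrix.toLin_mul B B B, h]
    change Matrix.toLin B B M * (1 + a.toLinearMap) ∈ I
    rw [mul_add, mul_one]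
    exact I.add_mem hM (hr a ha _ hM)
  have hbase : Matrix.single 4 1 1 ∈ I' := by
    have : Matrix.single 4 1 1 = N 0 1 * N 2 3 := by
      simp only [N]
      decide
    rw [this]
    exact hNl 0 1 (by decide) _ (hN 2 3 (by decide))
  have hne : ∀ p, oldIndex p ≠ newIndex p := by decide
  have hleft (p q : Fin 6) (h : Matrix.single p q 1 ∈ I') :
      Matrix.single (nextPair p) q 1 ∈ I' := by
    have : Matrix.single (nextPair p) q 1 =
        N (oldIndex p) (newIndex p) * Matrix.single p q 1 := by
      have hcol : ∀ p r, N (oldIndex p) (newIndex p) r p = if nextPair p = r then 1 else 0 := by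
        simp only [N]
        decide
      ext r s
      by_cases hs : q = s
      · subst hs
        rw [Matrix.mul_single_apply_same, hcol, Matrix.single_apply, mul_one]
        simp
      · rw [Matrix.mul_single_apply_of_ne _ _ _ _ _ (Ne.symm hs), Matrix.single_apply]
        simp [hs]
    rw [this]
    exact hNl _ _ (hne p) _ h
  have hright (p q : Fin 6) (h : Matrix.single p q 1 ∈ I') :
      Matrix.single p (nextPair q) 1 ∈ I' := by
    have : Matrix.single p (nextPair q) 1 =
        Matrix.single p q 1 * N (newIndex q) (oldIndex q) := by
      have hrow : ∀ q r, N (newIndex q) (oldIndex q) q r = if nextPair q = r then 1 else 0 := by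
        simp only [N]
        decide
      ext r s
      by_cases hs : p = r
      · subst hs
        rw [Matrix.single_mul_apply_same, hrow, Matrix.single_apply, one_mul]
        simp
      · rw [Matrix.single_mul_apply_of_ne _ _ _ _ _ (Ne.symm hs), Matrix.single_apply]
        simp [hs]
    rw [this]
    exact hNr _ _ (hne q).symm _ h
  have hcycle (P : Fin 6 → Prop) (q : Fin 6) (hq : P q) (h : ∀ p, P p → P (nextPair p)) (p) :
      P p := by
    have : ∀ p q : Fin 6, ∃ k : Fin 6, nextPair^[k] q = p := by decide
    obtain ⟨k, rfl⟩ := this p q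
    generalize (k : ℕ) = k
    induction k with
    | zero => exact hq
    | succ k ih =>
      rw [Function.iterate_succ_apply']
      exact h _ ih
  have hsingle (p q : Fin 6) : Matrix.single p q 1 ∈ I' :=
    hcycle (fun q => Matrix.single p q 1 ∈ I') 1
      (hcycle (fun p => Matrix.single p 1 1 ∈ I') 4 hbase (fun p => hleft p 1) p)
      (hright p) q
  rw [eq_top_iff]
  intro m _
  have hm : m = Matrix.toLin B B (∑ p, ∑ q, Matrix.single p q (LinearMap.toMatrix B B m p q)) := by
    rw [← Matrix.matrix_eq_sum_single, Matrix.toLin_toMatrix]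
  rw [hm, map_sum]
  refine I.sum_mem fun p _ => ?_
  rw [map_sum]
  refine I.sum_mem fun q _ => ?_
  rcases zmod2_cases (LinearMap.toMatrix B B m p q) with h | h
  · rw [h, Matrix.single_zero, map_zero]
    exact I.zero_mem
  · rw [h]
    exact hsingle p q

/-! ### Two blocks of the even subcode -/

theorem logicalPerm_one {n : ℕ} {C₁ C₂ : Submodule (ZMod 2) (Word n)} :
    logicalPerm (1 : jointAut C₁ C₂) = LinearEquiv.refl _ _ := by
  refine LinearEquiv.ext fun x => ?_
  obtain ⟨v, rfl⟩ := Submodule.Quotient.mk_surjective _ x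
  rfl

theorem firstBlock_logicalPerm_mem {n : ℕ} {C₁ C₂ : Submodule (ZMod 2) (Word n)}
    (π : jointAut C₁ C₂) : firstBlock _ (logicalPerm π) ∈ G12 C₁ C₂ := by
  refine Subgroup.subset_closure (Or.inr ⟨π, 1, ?_⟩)
  rw [logicalPerm_one]
  rfl

theorem secondBlock_logicalPerm_mem {n : ℕ} {C₁ C₂ : Submodule (ZMod 2) (Word n)}
    (π : jointAut C₁ C₂) : secondBlock (logicalPerm π) ∈ G12 C₁ C₂ := by
  refine Subgroup.subset_closure (Or.inr ⟨1, π, ?_⟩)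
  rw [logicalPerm_one]
  rfl

theorem cnot₁₂_mem_G12 {n : ℕ} (C₁ C₂ : Submodule (ZMod 2) (Word n)) :
    cnot₁₂ _ ∈ G12 C₁ C₂ :=
  Subgroup.subset_closure (Or.inl (Or.inl rfl))

theorem cnot₂₁_mem_G12 {n : ℕ} (C₁ C₂ : Submodule (ZMod 2) (Word n)) :
    cnot₂₁ _ ∈ G12 C₁ C₂ :=
  Subgroup.subset_closure (Or.inl (Or.inr rfl))

theorem G12_even : G12 (evenSubcode (hamming e)) (simplex e) = ⊤ := by
  let Φ : (AltSpace e × PUnit) ≃ₗ[ZMod 2] AltSpace e := LinearEquiv.prodUnique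
  have hext (a : AltSpace e ≃ₗ[ZMod 2] AltSpace e) : extendAut Φ a = a :=
    LinearEquiv.ext fun _ => rfl
  rw [eq_top_iff]
  intro f _
  have h := blockEmb_mem Φ (cnot₁₂_mem_G12 _ _) (cnot₂₁_mem_G12 _ _)
    (augmentationFull_logicalPerm e)
    (by rintro _ ⟨π, rfl⟩; rw [hext]; exact firstBlock_logicalPerm_mem π)
    (by rintro _ ⟨π, rfl⟩; rw [hext]; exact secondBlock_logicalPerm_mem π) f
  have hf : blockEmb Φ (f, 1) = f := (blockEmb_eq_iff Φ f 1 f).2 fun _ => rfl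
  rwa [hf] at h

/-! ### The all-one word as a complement -/

/-- The space `H / C`. -/
abbrev FullSpace : Type := Logical (hamming e) (simplex e)

/-- The inclusion of `H₀ / C` in `H / C`. -/
def inclAlt : AltSpace e →ₗ[ZMod 2] FullSpace e :=
  Submodule.mapQ _ _ (Submodule.inclusion (even_le_hamming e)) fun _ hx => hx

/-- The all-one word as an element of the Hamming code. -/
def oneWord : hamming e := ⟨1, one_mem_hamming e⟩

/-- The coset of the all-one word. -/
def oneCoset : FullSpace e := coset (hamming e) (simplex e) (oneWord e)

theorem inclAlt_coset (c : evenSubcode (hamming e)) :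
    inclAlt e (coset _ (simplex e) c) =
      coset (hamming e) (simplex e) (Submodule.inclusion (even_le_hamming e) c) := rfl

theorem inclAlt_add_smul_oneCoset (c : evenSubcode (hamming e)) (t : ZMod 2) :
    inclAlt e (coset _ (simplex e) c) + t • oneCoset e = coset (hamming e) (simplex e)
      (Submodule.inclusion (even_le_hamming e) c + t • oneWord e) := by
  rw [inclAlt_coset, oneCoset, ← Submodule.Quotient.mk_smul, ← Submodule.Quotient.mk_add]

theorem splitting_bijective : Function.Bijective
    ((inclAlt e).coprod (LinearMap.toSpanSingleton (ZMod 2) _ (oneCoset e))) := by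
  constructor
  · rw [← LinearMap.ker_eq_bot, LinearMap.ker_eq_bot']
    rintro ⟨x, t⟩ h
    obtain ⟨c, rfl⟩ := Submodule.Quotient.mk_surjective _ x
    rw [LinearMap.coprod_apply, LinearMap.toSpanSingleton_apply, inclAlt_add_smul_oneCoset,
      Submodule.Quotient.mk_eq_zero] at h
    have hmem : (c : Word 15) + t • 1 ∈ simplex e := h
    have ht : t = 0 := by
      by_contra h0
      have h1 := sub_mem (simplex_le_even e hmem) c.2
      rw [zmod2_eq_one h0, add_sub_cancel_left, one_smul] at h1
      exact one_notMem_even e h1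
    subst ht
    rw [zero_smul, add_zero] at hmem
    exact Prod.ext ((Submodule.Quotient.mk_eq_zero _).2 hmem) rfl
  · intro y
    obtain ⟨c, rfl⟩ := Submodule.Quotient.mk_surjective _ y
    obtain ⟨t, ht⟩ := exists_even_add_smul_one e c.2
    refine ⟨(coset (evenSubcode (hamming e)) (simplex e) ⟨_, ht⟩, t), ?_⟩
    rw [LinearMap.coprod_apply, LinearMap.toSpanSingleton_apply, inclAlt_add_smul_oneCoset]
    congr 1
    exact Subtype.ext (sub_add_cancel _ _)

/-- The decomposition `H / C = H₀ / C ⊕ ⟨1⟩`. -/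
def splitting : (AltSpace e × ZMod 2) ≃ₗ[ZMod 2] FullSpace e :=
  LinearEquiv.ofBijective _ (splitting_bijective e)

theorem splitting_coset (c : evenSubcode (hamming e)) (t : ZMod 2) :
    splitting e (coset _ (simplex e) c, t) = coset (hamming e) (simplex e)
      (Submodule.inclusion (even_le_hamming e) c + t • oneWord e) :=
  inclAlt_add_smul_oneCoset e c t

theorem extendAut_logicalPerm {π : jointAut (evenSubcode (hamming e)) (simplex e)}
    {π' : jointAut (hamming e) (simplex e)} (h : π.1 = π'.1) :
    extendAut (splitting e) (logicalPerm π) = logicalPerm π' := by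
  refine LinearEquiv.ext fun x => ?_
  obtain ⟨⟨y, t⟩, rfl⟩ := (splitting e).surjective x
  obtain ⟨c, rfl⟩ := Submodule.Quotient.mk_surjective _ y
  rw [extendAut_apply]
  change splitting e (logicalPerm π (coset _ _ c), t) =
    logicalPerm π' (splitting e (coset _ _ c, t))
  rw [logicalPerm_coset, splitting_coset, splitting_coset, logicalPerm_coset]
  congr 1
  apply Subtype.ext
  change permWord π.1 c + t • 1 = permWord π'.1 ((c : Word 15) + t • 1)
  rw [h, map_add, map_smul]
  rfl

/-- On two blocks, the group is the full linear group on the alternating forms times the group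
generated by the CNOTs on the two copies of the all-one word. -/
theorem G12_hamming :
    G12 (hamming e) (simplex e) = (blockEmb (splitting e)).range := by
  have hA (π : jointAut (hamming e) (simplex e)) :
      ∃ σ : jointAut (evenSubcode (hamming e)) (simplex e),
        logicalPerm π = extendAut (splitting e) (logicalPerm σ) := by
    have h : π.1 ∈ jointAut (evenSubcode (hamming e)) (simplex e) := by
      rw [jointAut_even]
      exact π.2.2
    exact ⟨⟨π.1, h⟩, (extendAut_logicalPerm e rfl).symm⟩
  have hA' (σ : jointAut (evenSubcode (hamming e)) (simplex e)) :
      ∃ π : jointAut (hamming e) (simplex e),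
        extendAut (splitting e) (logicalPerm σ) = logicalPerm π := by
    have h : σ.1 ∈ jointAut (hamming e) (simplex e) := by
      rw [jointAut_hamming]
      exact σ.2.2
    exact ⟨⟨σ.1, h⟩, extendAut_logicalPerm e rfl⟩
  apply le_antisymm
  · refine (Subgroup.closure_le _).2 ?_
    rintro _ ((rfl | rfl) | ⟨π₁, π₂, rfl⟩)
    · exact ⟨_, blockEmb_cnot₁₂ _⟩
    · exact ⟨_, blockEmb_cnot₂₁ _⟩
    · obtain ⟨σ₁, h₁⟩ := hA π₁
      obtain ⟨σ₂, h₂⟩ := hA π₂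
      exact ⟨_, (blockEmb_prodCongr _ _ _).trans (by rw [h₁, h₂])⟩
  · have hfst := blockEmb_mem (splitting e) (cnot₁₂_mem_G12 _ _) (cnot₂₁_mem_G12 _ _)
      (augmentationFull_logicalPerm e)
      (by
        rintro _ ⟨σ, rfl⟩
        obtain ⟨π, h⟩ := hA' σ
        rw [h]
        exact firstBlock_logicalPerm_mem π)
      (by
        rintro _ ⟨σ, rfl⟩
        obtain ⟨π, h⟩ := hA' σ
        rw [h]
        exact secondBlock_logicalPerm_mem π)
    have hsnd : (G12 (hamming e) (simplex e)).comap
        ((blockEmb (splitting e)).comp (MonoidHom.inr _ _)) = ⊤ := by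
      apply eq_top_of_cnot_mem
      · change blockEmb (splitting e) (1, cnot₁₂ (ZMod 2)) ∈ G12 _ _
        have : blockEmb (splitting e) (1, cnot₁₂ (ZMod 2)) =
            (blockEmb (splitting e) (cnot₁₂ _, 1))⁻¹ * cnot₁₂ _ := by
          rw [eq_inv_mul_iff_mul_eq, ← map_mul, ← blockEmb_cnot₁₂ (splitting e)]
          rfl
        rw [this]
        exact Subgroup.mul_mem _ (Subgroup.inv_mem _ (hfst _)) (cnot₁₂_mem_G12 _ _)
      · change blockEmb (splitting e) (1, cnot₂₁ (ZMod 2)) ∈ G12 _ _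
        have : blockEmb (splitting e) (1, cnot₂₁ (ZMod 2)) =
            (blockEmb (splitting e) (cnot₂₁ _, 1))⁻¹ * cnot₂₁ _ := by
          rw [eq_inv_mul_iff_mul_eq, ← map_mul, ← blockEmb_cnot₂₁ (splitting e)]
          rfl
        rw [this]
        exact Subgroup.mul_mem _ (Subgroup.inv_mem _ (hfst _)) (cnot₂₁_mem_G12 _ _)
    rintro _ ⟨⟨g, h⟩, rfl⟩
    have hh : h ∈ (G12 (hamming e) (simplex e)).comap
        ((blockEmb (splitting e)).comp (MonoidHom.inr _ _)) := hsnd ▸ Subgroup.mem_top h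
    have : blockEmb (splitting e) (g, h) =
        blockEmb (splitting e) (g, 1) * blockEmb (splitting e) (1, h) := by
      rw [← map_mul]
      rfl
    rw [this]
    exact Subgroup.mul_mem _ (hfst g) hh

end LogicalSpaces

section LogicalGroups

variable (e : Fin 15 ≃ {v : Fin 4 → ZMod 2 // v ≠ 0})

/-! ### One block -/

theorem eq_firstBlock {W : Type*} [AddCommGroup W] [Module (ZMod 2) W]
    {g : (W × W) ≃ₗ[ZMod 2] (W × W)} (h1 : ∀ x y, (g (x, y)).1 = (g (x, 0)).1)
    (h2 : ∀ x y, (g (x, y)).2 = y) : ∃ a, g = firstBlock W a := by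
  have h3 (x : W) : g (x, 0) = ((g (x, 0)).1, 0) := Prod.ext rfl (h2 x 0)
  have h4 (x : W) : g.symm (x, 0) = ((g.symm (x, 0)).1, 0) := by
    refine Prod.ext rfl ?_
    have := h2 (g.symm (x, 0)).1 (g.symm (x, 0)).2
    rw [Prod.mk.eta, g.apply_symm_apply] at this
    exact this.symm
  let a : W ≃ₗ[ZMod 2] W := LinearEquiv.ofLinearMap
    (LinearMap.fst (ZMod 2) W W ∘ₗ g.toLinearMap ∘ₗ LinearMap.inl (ZMod 2) W W)
    (LinearMap.fst (ZMod 2) W W ∘ₗ g.symm.toLinearMap ∘ₗ LinearMap.inl (ZMod 2) W W)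
    (by
      ext x
      change (g ((g.symm (x, 0)).1, 0)).1 = x
      rw [← h4, g.apply_symm_apply])
    (by
      ext x
      change (g.symm ((g (x, 0)).1, 0)).1 = x
      rw [← h3, g.symm_apply_apply])
  exact ⟨a, LinearEquiv.ext fun p => Prod.ext (h1 p.1 p.2) (h2 p.1 p.2)⟩

theorem blockEmb_firstBlock {W T V : Type*} [AddCommGroup W] [Module (ZMod 2) W]
    [AddCommGroup T] [Module (ZMod 2) T] [AddCommGroup V] [Module (ZMod 2) V]
    (Φ : (W × T) ≃ₗ[ZMod 2] V) (a : W ≃ₗ[ZMod 2] W) :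
    blockEmb Φ (firstBlock W a, 1) = firstBlock V (extendAut Φ a) := by
  have h1 : extendAut Φ (LinearEquiv.refl (ZMod 2) W) = LinearEquiv.refl (ZMod 2) V :=
    LinearEquiv.ext fun x => Φ.apply_symm_apply x
  have := blockEmb_prodCongr Φ a (LinearEquiv.refl (ZMod 2) W)
  rwa [h1] at this

theorem linearAut_zmod2 (b : ZMod 2 ≃ₗ[ZMod 2] ZMod 2) : b = 1 := by
  have h1 : b 1 = 1 := zmod2_eq_one fun h => one_ne_zero (b.map_eq_zero_iff.1 h)
  refine LinearEquiv.ext fun t => ?_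
  rcases zmod2_cases t with rfl | rfl
  · exact map_zero b
  · exact h1

/-- The elements of the two-block group that act on the first block only are the linear maps of the
alternating forms: on the all-one word there is no nontrivial linear map. -/
theorem G1tilde_hamming : G1tilde (hamming e) (simplex e) =
    ((blockEmb (splitting e)).comp
      ((MonoidHom.inl _ _).comp (firstBlock (AltSpace e)))).range := by
  apply le_antisymm
  · rintro x ⟨hx, f, hf⟩
    rw [SetLike.mem_coe, G12_hamming] at hx
    obtain ⟨⟨g, h⟩, rfl⟩ := hx
    have H := (blockEmb_eq_iff _ _ _ _).1 hf.symm
    have Hfst (x y : AltSpace e) (s t : ZMod 2) :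
        splitting e ((g (x, y)).1, (h (s, t)).1) = f (splitting e (x, s)) :=
      congrArg Prod.fst (H ((x, y), (s, t)))
    have Hsnd (x y : AltSpace e) (s t : ZMod 2) :
        ((g (x, y)).2, (h (s, t)).2) = (y, t) :=
      (splitting e).injective (congrArg Prod.snd (H ((x, y), (s, t))))
    have Hfst' (x y : AltSpace e) (s t : ZMod 2) :
        ((g (x, y)).1, (h (s, t)).1) = ((g (x, 0)).1, (h (s, 0)).1) :=
      (splitting e).injective ((Hfst x y s t).trans (Hfst x 0 s 0).symm)
    obtain ⟨a, rfl⟩ := eq_firstBlock (g := g) (fun x y => (Prod.mk.inj (Hfst' x y 0 0)).1)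
      (fun x y => (Prod.mk.inj (Hsnd x y 0 0)).1)
    obtain ⟨b, rfl⟩ := eq_firstBlock (g := h) (fun s t => (Prod.mk.inj (Hfst' 0 0 s t)).2)
      (fun s t => (Prod.mk.inj (Hsnd 0 0 s t)).2)
    refine ⟨a, ?_⟩
    rw [linearAut_zmod2 b, map_one]
    rfl
  · rintro _ ⟨a, rfl⟩
    refine ⟨?_, extendAut (splitting e) a, (blockEmb_firstBlock _ a).symm⟩
    rw [SetLike.mem_coe, G12_hamming]
    exact ⟨_, rfl⟩

/-- The linear automorphisms of `H₀ / C`. -/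
def altAutEquivSL :
    (AltSpace e ≃ₗ[ZMod 2] AltSpace e) ≃* Matrix.SpecialLinearGroup (Fin 6) (ZMod 2) :=
  linearAutEquivSL (quadBasis e)

/-- The linear automorphisms of two copies of `H₀ / C`. -/
def altPairAutEquivSL :
    ((AltSpace e × AltSpace e) ≃ₗ[ZMod 2] (AltSpace e × AltSpace e)) ≃*
      Matrix.SpecialLinearGroup (Fin 12) (ZMod 2) :=
  linearAutEquivSL (((quadBasis e).prod (quadBasis e)).reindex finSumFinEquiv)

/-- The linear automorphisms of two copies of `𝔽₂`. -/
def zmodPairAutEquivSL :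
    ((ZMod 2 × ZMod 2) ≃ₗ[ZMod 2] (ZMod 2 × ZMod 2)) ≃*
      Matrix.SpecialLinearGroup (Fin 2) (ZMod 2) :=
  linearAutEquivSL (Module.Basis.finTwoProd (ZMod 2))

/-- The one-block group of the Hamming code. -/
def G1tildeEquivSL :
    G1tilde (hamming e) (simplex e) ≃* Matrix.SpecialLinearGroup (Fin 6) (ZMod 2) :=
  (MulEquiv.subgroupCongr (G1tilde_hamming e)).trans
    ((MonoidHom.ofInjective (by
      intro a b h
      have h' := congrArg Prod.fst (blockEmb_injective _ h)
      refine LinearEquiv.ext fun x => ?_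
      exact congrArg Prod.fst (LinearEquiv.congr_fun h' (x, 0)))).symm.trans (altAutEquivSL e))

/-- The two-block group of the Hamming code. -/
def G12EquivSL :
    G12 (hamming e) (simplex e) ≃* Matrix.SpecialLinearGroup (Fin 12) (ZMod 2) ×
      Matrix.SpecialLinearGroup (Fin 2) (ZMod 2) :=
  (MulEquiv.subgroupCongr (G12_hamming e)).trans
    ((MonoidHom.ofInjective (blockEmb_injective (splitting e))).symm.trans
      ((altPairAutEquivSL e).prodCongr zmodPairAutEquivSL))

/-- The two-block group of the even subcode. -/
def G12EvenEquivSL :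
    G12 (evenSubcode (hamming e)) (simplex e) ≃*
      Matrix.SpecialLinearGroup (Fin 12) (ZMod 2) :=
  (MulEquiv.subgroupCongr (G12_even e)).trans (Subgroup.topEquiv.trans (altPairAutEquivSL e))

theorem card_SL (n : ℕ) : Nat.card (Matrix.SpecialLinearGroup (Fin n) (ZMod 2)) =
    ∏ i : Fin n, (2 ^ n - 2 ^ (i : ℕ)) := by
  rw [Nat.card_congr (slEquivGL n).toEquiv, Matrix.card_GL_field, ZMod.card]

theorem lt_card_G12 : 2 ^ 144 < Nat.card (G12 (hamming e) (simplex e)) := by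
  rw [Nat.card_congr (G12EquivSL e).toEquiv, Nat.card_prod, card_SL, card_SL]
  simp [Fin.prod_univ_succ]

/-! ### The action on the seven logical qubits -/

/-- The numbering of the six products of two coordinates, followed by the all-one word. -/
def blockIndex : Fin 6 ⊕ Fin 1 ≃ Fin 7 := finSumFinEquiv

/-- The products of two coordinates and the all-one word. -/
def monomialBasis : Module.Basis (Fin 7) (ZMod 2) (FullSpace e) :=
  (((quadBasis e).prod (Module.Basis.singleton (Fin 1) (ZMod 2))).map (splitting e)).reindex
    blockIndex

/-- The action of a substitution on the products of two coordinates and the constants. -/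
def compoundOne (A : Matrix (Fin 4) (Fin 4) (ZMod 2)) : Matrix (Fin 7) (Fin 7) (ZMod 2) :=
  (Matrix.fromBlocks (compound A) 0 0 (1 : Matrix (Fin 1) (Fin 1) (ZMod 2))).submatrix
    blockIndex.symm blockIndex.symm

/-- The columns are the members of a basis of `H / C`, in terms of `monomialBasis`, in which the
generators of `GL(4,2)` have the matrices `M₁` and `M₂`. -/
def qubitMatrix : Matrix (Fin 7) (Fin 7) (ZMod 2) :=
  !![0,1,0,0,0,0,1;
     0,0,1,0,0,0,0;
     0,0,1,1,0,1,0;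
     0,1,1,0,1,0,0;
     1,1,1,0,1,1,1;
     0,0,0,0,0,1,0;
     1,1,1,0,1,1,0]

/-- The inverse of `qubitMatrix`. -/
def qubitMatrixInv : Matrix (Fin 7) (Fin 7) (ZMod 2) :=
  !![0,0,0,1,0,1,1;
     1,0,0,0,1,0,1;
     0,1,0,0,0,0,0;
     0,1,1,0,0,1,0;
     1,1,0,1,1,0,1;
     0,0,0,0,0,1,0;
     0,0,0,0,1,0,1]

theorem qubitMatrix_mul_inv : qubitMatrix * qubitMatrixInv = 1 := by
  decide

theorem qubitMatrixInv_mul : qubitMatrixInv * qubitMatrix = 1 := by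
  decide

theorem compoundOne_genA : compoundOne genA.val * qubitMatrix = qubitMatrix * M₁ := by
  decide

theorem compoundOne_genB : compoundOne genB.val * qubitMatrix = qubitMatrix * M₂ := by
  decide

/-- The change of basis given by `qubitMatrix`. -/
def qubitEquiv : FullSpace e ≃ₗ[ZMod 2] FullSpace e :=
  LinearEquiv.ofLinearMap (Matrix.toLin (monomialBasis e) (monomialBasis e) qubitMatrix)
    (Matrix.toLin (monomialBasis e) (monomialBasis e) qubitMatrixInv)
    (by rw [← Matrix.toLin_mul, qubitMatrix_mul_inv, Matrix.toLin_one])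
    (by rw [← Matrix.toLin_mul, qubitMatrixInv_mul, Matrix.toLin_one])

theorem toLinearMap_qubitEquiv : (qubitEquiv e).toLinearMap =
    Matrix.toLin (monomialBasis e) (monomialBasis e) qubitMatrix :=
  LinearMap.ext fun _ => rfl

theorem toLinearMap_qubitEquiv_symm : (qubitEquiv e).symm.toLinearMap =
    Matrix.toLin (monomialBasis e) (monomialBasis e) qubitMatrixInv :=
  LinearMap.ext fun _ => rfl

/-- The basis of the seven logical qubits. -/
def qubitBasis : Module.Basis (Fin 7) (ZMod 2) (FullSpace e) :=
  (monomialBasis e).map (qubitEquiv e)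

theorem toMatrix_qubitBasis (f : Module.End (ZMod 2) (FullSpace e)) :
    LinearMap.toMatrix (qubitBasis e) (qubitBasis e) f =
      qubitMatrixInv * LinearMap.toMatrix (monomialBasis e) (monomialBasis e) f * qubitMatrix := by
  have : LinearMap.toMatrix (qubitBasis e) (qubitBasis e) f =
      LinearMap.toMatrix (monomialBasis e) (monomialBasis e)
        ((qubitEquiv e).symm.toLinearMap ∘ₗ f ∘ₗ (qubitEquiv e).toLinearMap) := by
    ext i j
    simp [LinearMap.toMatrix_apply, qubitBasis]
  rw [this, LinearMap.toMatrix_comp _ (monomialBasis e),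
    LinearMap.toMatrix_comp _ (monomialBasis e), ← Matrix.mul_assoc, toLinearMap_qubitEquiv, toLinearMap_qubitEquiv_symm,
    LinearMap.toMatrix_toLin, LinearMap.toMatrix_toLin]

theorem toMatrix_extendAut (a : AltSpace e ≃ₗ[ZMod 2] AltSpace e) :
    LinearMap.toMatrix (monomialBasis e) (monomialBasis e)
      (extendAut (splitting e) a).toLinearMap =
    (Matrix.fromBlocks (LinearMap.toMatrix (quadBasis e) (quadBasis e) a.toLinearMap) 0 0
      (1 : Matrix (Fin 1) (Fin 1) (ZMod 2))).submatrix blockIndex.symm blockIndex.symm := by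
  ext i j
  obtain ⟨i, rfl⟩ := blockIndex.surjective i
  obtain ⟨j, rfl⟩ := blockIndex.surjective j
  rcases i with i | i <;> rcases j with j | j
  on_goal 4 => obtain rfl := Subsingleton.elim i j
  all_goals simp [LinearMap.toMatrix_apply, monomialBasis, extendAut_apply]

theorem toMatrix_logicalPerm_hamming {π : jointAut (hamming e) (simplex e)}
    {A : GL (Fin 4) (ZMod 2)} (h : π.1 = permHom e A) :
    LinearMap.toMatrix (qubitBasis e) (qubitBasis e) (logicalPerm π).toLinearMap =
      qubitMatrixInv * compoundOne A.val * qubitMatrix := by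
  have hmem : π.1 ∈ jointAut (evenSubcode (hamming e)) (simplex e) := by
    rw [jointAut_even]
    exact π.2.2
  rw [toMatrix_qubitBasis, ← extendAut_logicalPerm e (π := ⟨π.1, hmem⟩) rfl, toMatrix_extendAut,
    toMatrix_logicalPerm e (π := ⟨π.1, hmem⟩) h]
  rfl

/-- The action of joint automorphisms on cosets. The inverse turns the right action `c ↦ c^π` into a
left action. -/
def logicalHom {n : ℕ} (C₁ C₂ : Submodule (ZMod 2) (Word n)) :
    jointAut C₁ C₂ →* (Logical C₁ C₂ ≃ₗ[ZMod 2] Logical C₁ C₂) where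
  toFun π := logicalPerm π⁻¹
  map_one' := by
    rw [inv_one, logicalPerm_one]
    rfl
  map_mul' π σ := by
    refine LinearEquiv.ext fun x => ?_
    obtain ⟨v, rfl⟩ := Submodule.Quotient.mk_surjective _ x
    change logicalPerm (π * σ)⁻¹ (coset C₁ C₂ v) = logicalPerm π⁻¹ (logicalPerm σ⁻¹ (coset C₁ C₂ v))
    rw [_root_.mul_inv_rev, logicalPerm_coset, logicalPerm_coset, logicalPerm_coset]
    rfl

/-- The joint automorphism induced by an element of `GL(4,2)`. -/
def jointHom : GL (Fin 4) (ZMod 2) →* jointAut (hamming e) (simplex e) :=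
  (permHom e).codRestrict _ fun A => by
    rw [jointAut_hamming, ← range_permHom]
    exact ⟨A, rfl⟩

theorem jointHom_surjective : Function.Surjective (jointHom e) := by
  intro π
  obtain ⟨A, hA⟩ : π.1 ∈ (permHom e).range := by
    rw [range_permHom]
    exact π.2.2
  exact ⟨A, Subtype.ext hA⟩

/-- The matrix group of the action of `GL(4,2)` on the seven logical qubits. -/
def qubitHom : GL (Fin 4) (ZMod 2) →* GL (Fin 7) (ZMod 2) :=
  (Units.map (LinearMap.toMatrixAlgEquiv (qubitBasis e)).toMonoidHom).comp
    ((LinearMap.GeneralLinearGroup.generalLinearEquiv (ZMod 2) _).symm.toMonoidHom.comp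
      ((logicalHom _ _).comp (jointHom e)))

theorem qubitHom_val (A : GL (Fin 4) (ZMod 2)) :
    (qubitHom e A).val = LinearMap.toMatrix (qubitBasis e) (qubitBasis e)
      (logicalPerm (jointHom e A⁻¹)).toLinearMap := by
  rw [map_inv]
  rfl

theorem qubitHom_inv_val {A : GL (Fin 4) (ZMod 2)} {M : Matrix (Fin 7) (Fin 7) (ZMod 2)}
    (h : compoundOne A.val * qubitMatrix = qubitMatrix * M) : (qubitHom e A⁻¹).val = M := by
  rw [qubitHom_val, inv_inv, toMatrix_logicalPerm_hamming e (A := A) rfl, Matrix.mul_assoc, h,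
    ← Matrix.mul_assoc, qubitMatrixInv_mul, Matrix.one_mul]

theorem G1_eq_range : G1 = (qubitHom e).range := by
  apply le_antisymm
  · refine (Subgroup.closure_le _).2 ?_
    rintro g (hg | hg)
    · exact ⟨genA⁻¹, Units.ext ((qubitHom_inv_val e compoundOne_genA).trans hg.symm)⟩
    · exact ⟨genB⁻¹, Units.ext ((qubitHom_inv_val e compoundOne_genB).trans hg.symm)⟩
  · have hmem {A : GL (Fin 4) (ZMod 2)} (h : qubitHom e A⁻¹ ∈ G1) : qubitHom e A ∈ G1 := by
      rw [map_inv] at h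
      exact inv_mem_iff.1 h
    rw [MonoidHom.range_eq_map, ← closure_genA_genB, MonoidHom.map_closure, Subgroup.closure_le]
    rintro _ ⟨g, rfl | rfl, rfl⟩
    · exact hmem (Subgroup.subset_closure (Or.inl (qubitHom_inv_val e compoundOne_genA)))
    · exact hmem (Subgroup.subset_closure (Or.inr (qubitHom_inv_val e compoundOne_genB)))

theorem mem_G1_iff (g : GL (Fin 7) (ZMod 2)) :
    g ∈ G1 ↔ ∃ π : jointAut (hamming e) (simplex e),
      g.val = LinearMap.toMatrix (qubitBasis e) (qubitBasis e) (logicalPerm π).toLinearMap := by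
  rw [G1_eq_range e]
  constructor
  · rintro ⟨A, rfl⟩
    exact ⟨_, qubitHom_val e A⟩
  · rintro ⟨π, hπ⟩
    obtain ⟨A, rfl⟩ := jointHom_surjective e π
    refine ⟨A⁻¹, Units.ext ?_⟩
    rw [qubitHom_val, inv_inv, hπ]

end LogicalGroups

end CSS

end

theorem mainTheorem8 (e : Fin 15 ≃ {v : Fin 4 → ZMod 2 // v ≠ 0}) :
    -- the classical codes and the automorphism group
    CSS.IsLinearCode (CSS.hamming e) 11 3 ∧
    CSS.IsLinearCode (CSS.simplex e) 4 8 ∧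
    CSS.dualCode (CSS.hamming e) = CSS.simplex e ∧
    CSS.dualCode (CSS.simplex e) = CSS.hamming e ∧
    CSS.simplex e ≤ CSS.hamming e ∧
    Nonempty (CSS.permAut (CSS.simplex e) ≃* alternatingGroup (Fin 8)) ∧
    Nat.card (CSS.permAut (CSS.simplex e)) = 20160 ∧
    CSS.jointAut (CSS.hamming e) (CSS.simplex e) = CSS.permAut (CSS.simplex e) ∧
    -- the quantum code and the action on its 7 logical qubits
    CSS.IsQuantumCode (CSS.codeSpace (CSS.hamming e) (CSS.simplex e)) 7 3 ∧
    (∃ b : Module.Basis (Fin 7) (ZMod 2) (CSS.Logical (CSS.hamming e) (CSS.simplex e)),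
      ∀ g : GL (Fin 7) (ZMod 2), g ∈ CSS.G1 ↔
        ∃ π : CSS.jointAut (CSS.hamming e) (CSS.simplex e),
          g.val = LinearMap.toMatrix b b (CSS.logicalPerm π).toLinearMap) ∧
    -- the groups on two blocks and on one block
    Nonempty (CSS.G12 (CSS.hamming e) (CSS.simplex e) ≃*
      Matrix.SpecialLinearGroup (Fin 12) (ZMod 2) ×
        Matrix.SpecialLinearGroup (Fin 2) (ZMod 2)) ∧
    2 ^ 144 < Nat.card (CSS.G12 (CSS.hamming e) (CSS.simplex e)) ∧
    Nonempty (CSS.G1tilde (CSS.hamming e) (CSS.simplex e) ≃*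
      Matrix.SpecialLinearGroup (Fin 6) (ZMod 2)) ∧
    (∀ g ∈ CSS.G12 (CSS.hamming e) (CSS.simplex e),
      ∃ U ∈ CSS.physicalGroup (CSS.hamming e) (CSS.simplex e),
        CSS.Realizes (CSS.hamming e) (CSS.simplex e) U g) ∧
    (∀ U ∈ CSS.physicalGroup (CSS.hamming e) (CSS.simplex e),
      ∃ g ∈ CSS.G12 (CSS.hamming e) (CSS.simplex e),
        CSS.Realizes (CSS.hamming e) (CSS.simplex e) U g) ∧
    -- the all-one vector and the logical operator `X^{⊗15}`
    (1 : CSS.Word 15) ∈ CSS.hamming e ∧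
    (1 : CSS.Word 15) ∉ CSS.simplex e ∧
    (∀ v : CSS.Word 15, CSS.pauli 1 0 (CSS.cosetState (CSS.simplex e) v) =
      CSS.cosetState (CSS.simplex e) (v + 1)) ∧
    (∀ π : Equiv.Perm (Fin 15), CSS.permWord π 1 = 1 ∧
      ∀ φ : CSS.Block 15, CSS.permuteQubits π (CSS.pauli 1 0 φ) =
        CSS.pauli 1 0 (CSS.permuteQubits π φ)) ∧
    -- the subcode obtained by removing the all-one vector
    CSS.simplex e ≤ CSS.evenSubcode (CSS.hamming e) ∧
    CSS.evenSubcode (CSS.hamming e) ⊓ Submodule.span (ZMod 2) {1} = ⊥ ∧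
    CSS.evenSubcode (CSS.hamming e) ⊔ Submodule.span (ZMod 2) {1} = CSS.hamming e ∧
    CSS.jointAut (CSS.evenSubcode (CSS.hamming e)) (CSS.simplex e) =
      CSS.permAut (CSS.simplex e) ∧
    CSS.codeSpace (CSS.evenSubcode (CSS.hamming e)) (CSS.simplex e) ≤
      CSS.codeSpace (CSS.hamming e) (CSS.simplex e) ∧
    CSS.IsQuantumCode (CSS.codeSpace (CSS.evenSubcode (CSS.hamming e)) (CSS.simplex e)) 6 3 ∧
    -- the full linear group on one block of the subcode
    Nonempty ((CSS.Logical (CSS.evenSubcode (CSS.hamming e)) (CSS.simplex e) ≃ₗ[ZMod 2]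
        CSS.Logical (CSS.evenSubcode (CSS.hamming e)) (CSS.simplex e)) ≃*
      Matrix.SpecialLinearGroup (Fin 6) (ZMod 2)) ∧
    (∀ h : CSS.Logical (CSS.evenSubcode (CSS.hamming e)) (CSS.simplex e) ≃ₗ[ZMod 2]
        CSS.Logical (CSS.evenSubcode (CSS.hamming e)) (CSS.simplex e),
      CSS.firstBlock _ h ∈ CSS.G1tilde (CSS.evenSubcode (CSS.hamming e)) (CSS.simplex e) ∧
      ∃ U ∈ CSS.physicalGroup (CSS.evenSubcode (CSS.hamming e)) (CSS.simplex e),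
        CSS.Realizes (CSS.evenSubcode (CSS.hamming e)) (CSS.simplex e) U
          (CSS.firstBlock _ h)) ∧
    -- the full linear group on two blocks of the subcode
    Nonempty (CSS.G12 (CSS.evenSubcode (CSS.hamming e)) (CSS.simplex e) ≃*
      Matrix.SpecialLinearGroup (Fin 12) (ZMod 2)) ∧
    (∀ g : (CSS.Logical (CSS.evenSubcode (CSS.hamming e)) (CSS.simplex e) ×
          CSS.Logical (CSS.evenSubcode (CSS.hamming e)) (CSS.simplex e)) ≃ₗ[ZMod 2]
        (CSS.Logical (CSS.evenSubcode (CSS.hamming e)) (CSS.simplex e) ×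
          CSS.Logical (CSS.evenSubcode (CSS.hamming e)) (CSS.simplex e)),
      g ∈ CSS.G12 (CSS.evenSubcode (CSS.hamming e)) (CSS.simplex e) ∧
      ∃ U ∈ CSS.physicalGroup (CSS.evenSubcode (CSS.hamming e)) (CSS.simplex e),
        CSS.Realizes (CSS.evenSubcode (CSS.hamming e)) (CSS.simplex e) U g) := by
  refine ⟨CSS.isLinearCode_hamming e, CSS.isLinearCode_simplex e, CSS.dualCode_hamming e,
    CSS.dualCode_simplex e, CSS.simplex_le_hamming e, ?_, ?_, CSS.jointAut_hamming e,
    CSS.isQuantumCode_of_even_le e (CSS.even_le_hamming e) le_rfl (CSS.finrank_logical_hamming e),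
    ⟨CSS.qubitBasis e, CSS.mem_G1_iff e⟩, ⟨CSS.G12EquivSL e⟩, CSS.lt_card_G12 e,
    ⟨CSS.G1tildeEquivSL e⟩, fun g hg => CSS.exists_realizes_of_mem_G12 hg,
    fun U hU => CSS.exists_realizes_of_mem_physicalGroup hU, CSS.one_mem_hamming e,
    fun h => CSS.one_notMem_even e (CSS.simplex_le_even e h),
    fun v => CSS.pauli_cosetState _ 1 v, fun π => ⟨rfl, CSS.permuteQubits_pauli_one π⟩,
    CSS.simplex_le_even e, CSS.even_inf_span_one e, CSS.even_sup_span_one e, CSS.jointAut_even e,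
    CSS.codeSpace_mono (CSS.even_le_hamming e),
    CSS.isQuantumCode_of_even_le e le_rfl (CSS.even_le_hamming e) (CSS.finrank_logical_even e),
    ⟨CSS.altAutEquivSL e⟩, fun h => ?_, ⟨CSS.G12EvenEquivSL e⟩, fun g => ?_⟩
  · obtain ⟨f⟩ := CSS.nonempty_GL_four_mulEquiv
    exact ⟨(CSS.GLEquivPermAut e).symm.trans f⟩
  · rw [← Nat.card_congr (CSS.GLEquivPermAut e).toEquiv, CSS.card_GL_four]
  · have hmem : CSS.firstBlock _ h ∈ CSS.G12 (CSS.evenSubcode (CSS.hamming e)) (CSS.simplex e) := by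
      rw [CSS.G12_even]
      exact Subgroup.mem_top _
    exact ⟨⟨hmem, h, rfl⟩, CSS.exists_realizes_of_mem_G12 hmem⟩
  · have hmem : g ∈ CSS.G12 (CSS.evenSubcode (CSS.hamming e)) (CSS.simplex e) := by
      rw [CSS.G12_even]
      exact Subgroup.mem_top _
    exact ⟨hmem, CSS.exists_realizes_of_mem_G12 hmem⟩
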